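/- For linear orderings $A,B$ and finite tuples $\bar a\in A^n$, $\bar b\in B^n$, let $(A,\bar a)\le_0(B,\bar b)$ mean that $a_i\le a_j\iff b_i\le b_j$ for all $i,j$, and for an ordinal $\alpha>0$ let $(A,\bar a)\le_\alpha(B,\bar b)$ mean that for every $\beta<\alpha$ and every finite tuple $\bar d$ of elements of $B$ there is a tuple $\bar c$ of elements of $A$ of the same length such that $(B,\bar b\bar d)\le_\beta(A,\bar a\bar c)$. Write $A\le_\alpha B$ when this holds for the empty tuples. For isomorphism-invariant classes $K_0\subseteq K_1$ of linear orderings, $K_0$ is $\alpha$-universal for $K_1$ if for every $A\in K_1$ there is $B\in K_0$ with $A\le_\alpha B$. For $k\in\mathbb N$ write $k$ also for the $k$-element linear ordering, $\omega^*$ for the reverse of $\omega$, and $m\cdot\mathbb Q$ for the ordering obtained from $\mathbb Q$ by replacing every point by a chain of $m$ points (empty if $m=0$). Let $K$ be the class of all linear orderings isomorphic to one of the following: 1. $\omega+k$, $k+\omega^*$ or $k+\mathbb Z+k'$, with $k,k'\in\mathbb N$; 2. $\omega+\omega^*$; 3. $n_0+m_0\cdot\mathbb Q+n_1+m_1\cdot\mathbb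 Q+\dots+n_{k-1}+m_{k-1}\cdot\mathbb Q+n_k$, with $k\in\mathbb N$ and $n_i,m_i\in\mathbb N$ such that $n_i>m_{i-1}$ and $n_i>m_i$ for all $0<i<k$ (with no condition on $n_0$ and $n_k$); 4. the finite ordering $k$, with $k\in\mathbb N$. **Theorem.** $K$ is an isomorphism-invariant class of countable linear orderings, and $K$ is $3$-universal for the class of all linear orderings and for the class of countable linear orderings. No isomorphism-invariant proper subclass $J\subsetneq K$ is $3$-universal for the class of countable linear orderings, nor for the class of all linear orderings. -/

import Mathlib

universe u

namespace ThreeUniversal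

/-- `(A, a) ≤_α (B, b)`: the standard asymmetric back-and-forth relation for linear orderings with
tuples of equal length. At level `0` the tuples have the same atomic diagram; at level `α > 0`,
for every `β < α` and every finite tuple `d` of `B` there is a tuple `c` of `A` of the same length
with `(B, b d) ≤_β (A, a c)`. For `α > 0` the second conjunct implies the first (take `β = 0` and
the empty `d`), so keeping the first conjunct at every level changes nothing. -/
def BackForth (α : Ordinal.{0}) (A B : Type u) [LinearOrder A] [LinearOrder B] (n : ℕ)
    (a : Fin n → A) (b : Fin n → B) : Prop :=
  (∀ i j : Fin n, a i ≤ a j ↔ b i ≤ b j) ∧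
    ∀ β : Ordinal.{0}, β < α → ∀ (m : ℕ) (d : Fin m → B), ∃ c : Fin m → A,
      BackForth β B A (n + m) (Fin.append b d) (Fin.append a c)
termination_by α
decreasing_by assumption

/-- `A ≤_α B` for linear orderings. -/
def LeAlpha (α : Ordinal.{0}) (A B : LinOrd.{u}) : Prop :=
  BackForth α A B 0 Fin.elim0 Fin.elim0

/-- A class of linear orderings is isomorphism invariant. -/
def IsoInvariant (C : Set LinOrd.{u}) : Prop :=
  ∀ A B : LinOrd.{u}, Nonempty (A ≃o B) → A ∈ C → B ∈ C

/-- `C₀` is `α`-universal for `C₁`: every member of `C₁` is `≤_α` some member of `C₀`. -/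
def IsUniversal (α : Ordinal.{0}) (C₀ C₁ : Set LinOrd.{u}) : Prop :=
  ∀ A ∈ C₁, ∃ B ∈ C₀, LeAlpha α A B

/-- The class of all linear orderings. -/
def LO : Set LinOrd.{u} := Set.univ

/-- The class of countable (possibly finite) linear orderings. -/
def CountableLO : Set LinOrd.{u} := {L | Countable L}

/-- The ordering `(∑_{i < k} (n_i + m_i · ℚ)) + n_k`, where `m · ℚ` is `ℚ` with every point
replaced by a chain of `m` points. -/
abbrev FiniteSum (k : ℕ) (n m : ℕ → ℕ) : Type :=
  (Σₗ i : Fin k, (Fin (n i) ⊕ₗ (ℚ ×ₗ Fin (m i)))) ⊕ₗ Fin (n k)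

/-- Every chain strictly inside the sum, `n_{i+1}` with `0 < i + 1 < k`, is larger than both of its
neighbours `m_i` and `m_{i+1}`; the two outermost chains are arbitrary. -/
def InnerDominates (k : ℕ) (n m : ℕ → ℕ) : Prop :=
  ∀ i : ℕ, i + 1 < k → m i < n (i + 1) ∧ m (i + 1) < n (i + 1)

/-- The class `K`: the orderings isomorphic to one of `ω + k`, `k + ω*`, `k + ℤ + k'`, `ω + ω*`,
an admissible finite sum of `n_i` and `m_i · ℚ`, or a finite ordering `k`. -/
def K : Set LinOrd.{u} :=
  {L | (∃ k : ℕ, Nonempty (L ≃o ℕ ⊕ₗ Fin k)) ∨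
    (∃ k : ℕ, Nonempty (L ≃o Fin k ⊕ₗ ℕᵒᵈ)) ∨
    (∃ k k' : ℕ, Nonempty (L ≃o (Fin k ⊕ₗ ℤ) ⊕ₗ Fin k')) ∨
    Nonempty (L ≃o ℕ ⊕ₗ ℕᵒᵈ) ∨
    (∃ (k : ℕ) (n m : ℕ → ℕ), InnerDominates k n m ∧ Nonempty (L ≃o FiniteSum k n m)) ∨
    (∃ k : ℕ, Nonempty (L ≃o Fin k))}

end ThreeUniversal

-- The relation is read as a game on finite relations between the two orderings. Level one compares
-- sizes: `A ≤₁ B` says that `A` has at least as many elements as `B`. At level two a finite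
-- interval enumerated in `B` must be answered by an interval of the same size in `A`. Hence `≤₃`,
-- which implies `≤₂` in both directions, preserves the number of runs of each finite length N
-- (intervals with exactly N elements) and the sizes of the maximal runs at the two ends.
--
-- Universality splits on the lengths of finite intervals. If they are unbounded, the end runs
-- decide the model. Each end run is finite or infinite, giving `ω + ω*`, `ω + k`, `k + ω*` or `k +
-- ℤ + k'`. The answer copies a long enough run and leaves the rest to a level-two comparison: `ω`
-- lies below every nonempty ordering without maximum, `ω + ω*` below every infinite ordering. If
-- the lengths are bounded by N, induct on N. With infinitely many runs of length N, the ordering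
-- without its finite end runs is `≤₃ N · ℚ` (`le_three_prod`), because `N · ℚ` is `≤₂` every
-- nonempty ordering without endpoints whose runs have length at most N (`le_two_prod`). With
-- finitely many, cut out one of these runs and recurse on both sides. The chain cut out exceeds the
-- multiplicities on both sides of it, and this is where the inequalities defining the third family
-- come from (`exists_word_of_finite`).
--
-- Minimality follows once `≤₃` between members of `K` is isomorphism (`nonempty_iso_of_mem_K`): a
-- member missing from `J` has nothing in `J` above it. The unbounded models are told apart by their
-- end runs. For finite sums, the inequalities say that either the word is a single `n + m · ℚ + n'`
-- with `n, n' ≤ m`, or a longest chain exceeds every multiplicity and so occurs only finitely often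
-- (`GoodWord.dichotomy`). In the second case level three must match the leftmost longest run on
-- both sides. Cutting there leaves two smaller comparisons, and an induction on the total chain
-- length concludes.

universe v w x

namespace ThreeUniversal

open Set

/-! ### Back-and-forth on finite relations -/

section Relation

variable {A : Type u} {B : Type v} [LinearOrder A] [LinearOrder B]

/-- A relation is a partial isomorphism of linear orderings. -/
def PartialIso (r : Set (A × B)) : Prop :=
  ∀ p ∈ r, ∀ q ∈ r, p.1 ≤ q.1 ↔ p.2 ≤ q.2

/-- The back-and-forth relation of finite level with a finite relation in place of two tuples:
`Bf n true r` says `(A, r) ≤_n (B, r)` and `Bf n false r` says `(B, r) ≤_n (A, r)`. -/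
def Bf : ℕ → Bool → Set (A × B) → Prop
  | 0, _, r => PartialIso r
  | n + 1, true, r => ∀ s : Set B, s.Finite →
      ∃ r' : Set (A × B), r'.Finite ∧ r ⊆ r' ∧ s ⊆ Prod.snd '' r' ∧ Bf n false r'
  | n + 1, false, r => ∀ s : Set A, s.Finite →
      ∃ r' : Set (A × B), r'.Finite ∧ r ⊆ r' ∧ s ⊆ Prod.fst '' r' ∧ Bf n true r'

theorem PartialIso.mono {r r' : Set (A × B)} (h : r ⊆ r') (H : PartialIso r') : PartialIso r :=
  fun p hp q hq => H p (h hp) q (h hq)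

theorem PartialIso.lt_iff {r : Set (A × B)} (H : PartialIso r) {p q : A × B} (hp : p ∈ r)
    (hq : q ∈ r) : p.1 < q.1 ↔ p.2 < q.2 := by
  rw [← not_le, ← not_le, H q hq p hp]

theorem PartialIso.eq_iff {r : Set (A × B)} (H : PartialIso r) {p q : A × B} (hp : p ∈ r)
    (hq : q ∈ r) : p.1 = q.1 ↔ p.2 = q.2 := by
  rw [le_antisymm_iff, le_antisymm_iff, H q hq p hp, H p hp q hq]

theorem Bf.mono {n : ℕ} {d : Bool} {r r' : Set (A × B)} (h : r ⊆ r') (H : Bf n d r') :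
    Bf n d r := by
  match n, d, H with
  | 0, _, H => exact PartialIso.mono h H
  | n + 1, true, H =>
    intro s hs
    obtain ⟨t, ht, h1, h2⟩ := H s hs
    exact ⟨t, ht, h.trans h1, h2⟩
  | n + 1, false, H =>
    intro s hs
    obtain ⟨t, ht, h1, h2⟩ := H s hs
    exact ⟨t, ht, h.trans h1, h2⟩

theorem Bf.partialIso {n : ℕ} {d : Bool} {r : Set (A × B)} (H : Bf n d r) : PartialIso r := by
  induction n generalizing d r with
  | zero => exact H
  | succ n ih =>
    cases d <;>
    · obtain ⟨t, -, h1, -, h2⟩ := H ∅ finite_empty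
      exact (ih h2).mono h1

theorem Bf.of_succ {n : ℕ} {d : Bool} {r : Set (A × B)} (H : Bf (n + 1) d r) : Bf n d r := by
  induction n generalizing d r with
  | zero => exact H.partialIso
  | succ n ih =>
    cases d <;>
    · intro s hs
      obtain ⟨t, ht, h1, h2, h3⟩ := H s hs
      exact ⟨t, ht, h1, h2, ih h3⟩

theorem Bf.of_le {n m : ℕ} (h : m ≤ n) {d : Bool} {r : Set (A × B)} (H : Bf n d r) :
    Bf m d r := by
  induction n, h using Nat.le_induction with
  | base => exact H
  | succ n _ ih => exact ih H.of_succ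

/-- `P` and `Q` correspond to each other under every partial isomorphism that extends `r`. -/
def Linked (P : Set A) (Q : Set B) (r : Set (A × B)) : Prop :=
  ∀ r', r ⊆ r' → PartialIso r' → ∀ p ∈ r', p.1 ∈ P ↔ p.2 ∈ Q

theorem Linked.mono {P : Set A} {Q : Set B} {r r' : Set (A × B)} (h : r ⊆ r')
    (H : Linked P Q r) : Linked P Q r' :=
  fun t ht => H t (h.trans ht)

theorem linked_Iic {r : Set (A × B)} {p : A × B} (hp : p ∈ r) : Linked (Iic p.1) (Iic p.2) r :=
  fun _ h H q hq => H q hq p (h hp)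

theorem linked_Ici {r : Set (A × B)} {p : A × B} (hp : p ∈ r) : Linked (Ici p.1) (Ici p.2) r :=
  fun _ h H q hq => H p (h hp) q hq

theorem linked_Iio {r : Set (A × B)} {p : A × B} (hp : p ∈ r) : Linked (Iio p.1) (Iio p.2) r :=
  fun _ h H _ hq => H.lt_iff hq (h hp)

theorem linked_Ioi {r : Set (A × B)} {p : A × B} (hp : p ∈ r) : Linked (Ioi p.1) (Ioi p.2) r :=
  fun _ h H _ hq => H.lt_iff (h hp) hq

theorem linked_Icc {r : Set (A × B)} {p q : A × B} (hp : p ∈ r) (hq : q ∈ r) :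
    Linked (Icc p.1 q.1) (Icc p.2 q.2) r :=
  fun t h H c hc => and_congr (linked_Ici hp t h H c hc) (linked_Iic hq t h H c hc)

theorem linked_univ {r : Set (A × B)} : Linked univ univ r := fun _ _ _ _ _ => by simp

theorem encard_le_of_rel {α : Type u} {β : Type v} {P : Set α} {Q : Set β} (R : Set (α × β))
    (h : ∀ b ∈ Q, ∃ a ∈ P, (a, b) ∈ R) (inj : ∀ a b c, (a, b) ∈ R → (a, c) ∈ R → b = c) :
    Q.encard ≤ P.encard := by
  choose f hf hR using h
  refine Function.Embedding.encard_le ⟨fun b : Q => ⟨f b b.2, hf b b.2⟩, fun b c h => ?_⟩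
  have h : f b b.2 = f c c.2 := congrArg Subtype.val h
  have hc := hR c c.2
  rw [← h] at hc
  exact Subtype.ext (inj _ _ _ (hR b b.2) hc)

/-- The points of `s` have partners under `r`, and linkedness puts these partners in `P`. -/
theorem Linked.encard_le {P : Set A} {Q s : Set B} {r : Set (A × B)} (H : Linked P Q r)
    (h : PartialIso r) (hs : s ⊆ Q) (hQ : s ⊆ Prod.snd '' r) : s.encard ≤ P.encard := by
  refine encard_le_of_rel r (fun b hb => ?_) fun a b c hb hc => (h.eq_iff hb hc).1 rfl
  obtain ⟨p, hp, rfl⟩ := hQ hb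
  exact ⟨p.1, (H r le_rfl h p hp).2 (hs hb), hp⟩

theorem Linked.encard_le' {P s : Set A} {Q : Set B} {r : Set (A × B)} (H : Linked P Q r)
    (h : PartialIso r) (hs : s ⊆ P) (hP : s ⊆ Prod.fst '' r) : s.encard ≤ Q.encard := by
  refine encard_le_of_rel (Prod.swap ⁻¹' r) (fun b hb => ?_)
    fun a b c hb hc => (h.eq_iff hb hc).2 rfl
  obtain ⟨p, hp, rfl⟩ := hP hb
  exact ⟨p.2, (H r le_rfl h p hp).1 (hs hb), hp⟩

/-- An infinite set has subsets of every finite size. Hence one-move arguments, which only ever see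
finite sets, bound cardinalities in `ℕ∞`. -/
theorem encard_le_of_forall_finite {α : Type u} {β : Type v} {P : Set α} {Q : Set β}
    (h : ∀ s ⊆ P, s.Finite → s.encard ≤ Q.encard) : P.encard ≤ Q.encard := by
  by_cases hP : P.Finite
  · exact h P le_rfl hP
  · refine ENat.forall_natCast_le_iff_le.1 fun k _ => ?_
    obtain ⟨s, hs, hk⟩ := exists_subset_encard_eq (s := P) (k := k)
      (by rw [Set.Infinite.encard_eq hP]; exact le_top)
    rw [← hk]
    exact h s hs (finite_of_encard_eq_coe hk)

/-- Level one compares the cardinalities of corresponding sets. -/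
theorem Linked.encard_le_of_bf_true {P : Set A} {Q : Set B} {r : Set (A × B)} (H : Linked P Q r)
    (h : Bf 1 true r) : Q.encard ≤ P.encard := by
  refine encard_le_of_forall_finite fun s hs hf => ?_
  obtain ⟨t, -, h1, h2, h3⟩ := h s hf
  exact (H.mono h1).encard_le h3 hs h2

theorem Linked.encard_le_of_bf_false {P : Set A} {Q : Set B} {r : Set (A × B)}
    (H : Linked P Q r) (h : Bf 1 false r) : P.encard ≤ Q.encard := by
  refine encard_le_of_forall_finite fun s hs hf => ?_
  obtain ⟨t, -, h1, h2, h3⟩ := h s hf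
  exact (H.mono h1).encard_le' h3 hs h2

variable {X : Type w} {Y : Type x} [LinearOrder X] [LinearOrder Y]

theorem PartialIso.preimage {r : Set (A × B)} (h : PartialIso r) (f : X ↪o A) (g : Y ↪o B) :
    PartialIso (Prod.map f g ⁻¹' r) := by
  intro p hp q hq
  simpa using h _ hp _ hq

/-- Every answer to a move inside one range stays inside the linked range, so the winning strategy
localises to convex pieces cut out by points already played. -/
theorem Bf.restrict {n : ℕ} {d : Bool} {r : Set (A × B)} (h : Bf n d r) (f : X ↪o A)
    (g : Y ↪o B) (H : Linked (range f) (range g) r) : Bf n d (Prod.map f g ⁻¹' r) := by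
  have inj : Function.Injective (Prod.map f g) := f.injective.prodMap g.injective
  induction n generalizing d r with
  | zero => exact PartialIso.preimage h f g
  | succ n ih =>
    cases d with
    | true =>
      intro s hs
      obtain ⟨t, ht, h1, h2, h3⟩ := h (g '' s) (hs.image _)
      refine ⟨_, ht.preimage inj.injOn, preimage_mono h1, fun y hy => ?_, ih h3 (H.mono h1)⟩
      obtain ⟨p, hp, hpy⟩ := h2 (mem_image_of_mem g hy)
      obtain ⟨z, hz⟩ := (H t h1 h3.partialIso p hp).2 ⟨y, hpy.symm⟩
      exact ⟨(z, y), by simpa [hz, ← hpy] using hp, rfl⟩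
    | false =>
      intro s hs
      obtain ⟨t, ht, h1, h2, h3⟩ := h (f '' s) (hs.image _)
      refine ⟨_, ht.preimage inj.injOn, preimage_mono h1, fun y hy => ?_, ih h3 (H.mono h1)⟩
      obtain ⟨p, hp, hpy⟩ := h2 (mem_image_of_mem f hy)
      obtain ⟨z, hz⟩ := (H t h1 h3.partialIso p hp).1 ⟨y, hpy.symm⟩
      exact ⟨(y, z), by simpa [hz, ← hpy] using hp, rfl⟩

theorem Bf.map {n : ℕ} {d : Bool} {r : Set (A × B)} (h : Bf n d r) (f : A ≃ X) (g : B ≃ Y)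
    (H : ∀ r : Set (A × B), PartialIso r → PartialIso (Prod.map f g '' r)) :
    Bf n d (Prod.map f g '' r) := by
  induction n generalizing d r with
  | zero => exact H r h
  | succ n ih =>
    cases d with
    | true =>
      intro s hs
      obtain ⟨t, ht, h1, h2, h3⟩ := h (g ⁻¹' s) (hs.preimage g.injective.injOn)
      refine ⟨_, ht.image _, image_mono h1, fun y hy => ?_, ih h3⟩
      obtain ⟨p, hp, hpy⟩ := h2 (show g.symm y ∈ g ⁻¹' s by simpa using hy)
      exact ⟨_, mem_image_of_mem _ hp, by simp [hpy]⟩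
    | false =>
      intro s hs
      obtain ⟨t, ht, h1, h2, h3⟩ := h (f ⁻¹' s) (hs.preimage f.injective.injOn)
      refine ⟨_, ht.image _, image_mono h1, fun y hy => ?_, ih h3⟩
      obtain ⟨p, hp, hpy⟩ := h2 (show f.symm y ∈ f ⁻¹' s by simpa using hy)
      exact ⟨_, mem_image_of_mem _ hp, by simp [hpy]⟩

theorem Bf.map_orderIso {n : ℕ} {d : Bool} {r : Set (A × B)} (h : Bf n d r) (f : A ≃o X)
    (g : B ≃o Y) : Bf n d (Prod.map f g '' r) := by
  refine h.map f.toEquiv g.toEquiv fun r hr => ?_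
  rintro _ ⟨p, hp, rfl⟩ _ ⟨q, hq, rfl⟩
  simpa using hr p hp q hq

theorem Bf.dual {n : ℕ} {d : Bool} {r : Set (A × B)} (h : Bf n d r) :
    Bf n d (Prod.map OrderDual.toDual OrderDual.toDual '' r) := by
  refine h.map OrderDual.toDual OrderDual.toDual fun r hr => ?_
  rintro _ ⟨p, hp, rfl⟩ _ ⟨q, hq, rfl⟩
  simpa using hr q hq p hp

/-- The union of two relations, as a relation between ordered sums. -/
def sumRel (r : Set (A × B)) (t : Set (X × Y)) : Set ((A ⊕ₗ X) × (B ⊕ₗ Y)) :=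
  (fun p => (toLex (Sum.inl p.1), toLex (Sum.inl p.2))) '' r ∪
    (fun p => (toLex (Sum.inr p.1), toLex (Sum.inr p.2))) '' t

theorem PartialIso.sum {r : Set (A × B)} {t : Set (X × Y)} (h : PartialIso r)
    (h' : PartialIso t) : PartialIso (sumRel r t) := by
  rintro _ (⟨p, hp, rfl⟩ | ⟨p, hp, rfl⟩) _ (⟨q, hq, rfl⟩ | ⟨q, hq, rfl⟩)
  · simpa using h p hp q hq
  · simp
  · simp
  · simpa using h' p hp q hq

/-- The two summands are played independently. No comparison between the summands can fail, since
the left one is always below. -/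
theorem Bf.sum {n : ℕ} {d : Bool} {r : Set (A × B)} {t : Set (X × Y)} (h : Bf n d r)
    (h' : Bf n d t) : Bf n d (sumRel r t) := by
  induction n generalizing d r t with
  | zero => exact PartialIso.sum h h'
  | succ n ih =>
    cases d with
    | true =>
      intro s hs
      obtain ⟨r', hr, h1, h2, h3⟩ := h ((fun b => toLex (Sum.inl b)) ⁻¹' s)
        (hs.preimage fun _ _ _ _ h => by simpa using h)
      obtain ⟨t', ht, h1', h2', h3'⟩ := h' ((fun b => toLex (Sum.inr b)) ⁻¹' s)
        (hs.preimage fun _ _ _ _ h => by simpa using h)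
      refine ⟨_, (hr.image _).union (ht.image _), union_subset_union (image_mono h1)
        (image_mono h1'), fun y hy => ?_, ih h3 h3'⟩
      rcases y with y | y
      · obtain ⟨p, hp, rfl⟩ := h2 hy
        exact ⟨_, Or.inl (mem_image_of_mem _ hp), rfl⟩
      · obtain ⟨p, hp, rfl⟩ := h2' hy
        exact ⟨_, Or.inr (mem_image_of_mem _ hp), rfl⟩
    | false =>
      intro s hs
      obtain ⟨r', hr, h1, h2, h3⟩ := h ((fun b => toLex (Sum.inl b)) ⁻¹' s)
        (hs.preimage fun _ _ _ _ h => by simpa using h)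
      obtain ⟨t', ht, h1', h2', h3'⟩ := h' ((fun b => toLex (Sum.inr b)) ⁻¹' s)
        (hs.preimage fun _ _ _ _ h => by simpa using h)
      refine ⟨_, (hr.image _).union (ht.image _), union_subset_union (image_mono h1)
        (image_mono h1'), fun y hy => ?_, ih h3 h3'⟩
      rcases y with y | y
      · obtain ⟨p, hp, rfl⟩ := h2 hy
        exact ⟨_, Or.inl (mem_image_of_mem _ hp), rfl⟩
      · obtain ⟨p, hp, rfl⟩ := h2' hy
        exact ⟨_, Or.inr (mem_image_of_mem _ hp), rfl⟩

theorem Bf.swap {n : ℕ} {d : Bool} {r : Set (A × B)} (h : Bf n d r) :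
    Bf n (!d) (Prod.swap '' r) := by
  induction n generalizing d r with
  | zero =>
    rintro _ ⟨p, hp, rfl⟩ _ ⟨q, hq, rfl⟩
    exact (h p hp q hq).symm
  | succ n ih =>
    cases d <;>
    · intro s hs
      obtain ⟨t, ht, h1, h2, h3⟩ := h s hs
      refine ⟨_, ht.image _, image_mono h1, fun y hy => ?_, ih h3⟩
      obtain ⟨p, hp, rfl⟩ := h2 hy
      exact ⟨_, mem_image_of_mem _ hp, rfl⟩

end Relation

/-! ### From tuples and ordinals to relations and natural levels -/

section Tuples

theorem range_append_prod {A : Type u} {B : Type v} {n m : ℕ} (a : Fin n → A) (b : Fin n → B) (c : Fin m → A)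
    (d : Fin m → B) :
    range (fun i => (Fin.append a c i, Fin.append b d i)) =
      range (fun i => (a i, b i)) ∪ range (fun i => (c i, d i)) := by
  ext p
  constructor
  · rintro ⟨i, rfl⟩
    refine Fin.addCases (fun i => ?_) (fun i => ?_) i
    · exact Or.inl ⟨i, by simp⟩
    · exact Or.inr ⟨i, by simp⟩
  · rintro (⟨i, rfl⟩ | ⟨i, rfl⟩)
    · exact ⟨Fin.castAdd m i, by simp⟩
    · exact ⟨Fin.natAdd n i, by simp⟩

theorem swap_image_range_prod {A : Type u} {B : Type v} {n : ℕ} (a : Fin n → A) (b : Fin n → B) :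
    Prod.swap '' range (fun i => (a i, b i)) = range (fun i => (b i, a i)) := by
  rw [← range_comp]; rfl

variable {A B : Type u} [LinearOrder A] [LinearOrder B]

/-- Levels below `n` are natural numbers, and by `Bf.of_le` it suffices to answer at level `n - 1`.
That an answer in `Bf` may contain extra pairs is harmless: by `Bf.mono` it can be cut down to the
graph of the chosen tuple. -/
theorem backForth_natCast_iff (n : ℕ) {k : ℕ} (a : Fin k → A) (b : Fin k → B) :
    BackForth (n : Ordinal.{0}) A B k a b ↔ Bf n true (range fun i => (a i, b i)) := by
  induction n using Nat.strong_induction_on generalizing A B k with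
  | _ n ih =>
    have atomic : PartialIso (range fun i => (a i, b i)) ↔ ∀ i j, a i ≤ a j ↔ b i ≤ b j := by
      simp [PartialIso]
    rw [BackForth]
    constructor
    · rintro ⟨h0, h⟩
      cases n with
      | zero => exact atomic.2 h0
      | succ n =>
        intro s hs
        obtain ⟨m, d, -, hd⟩ := hs.fin_param
        obtain ⟨c, hc⟩ := h (n : Ordinal.{0}) (by exact_mod_cast n.lt_succ_self) m d
        rw [ih n n.lt_succ_self] at hc
        have := hc.swap
        rw [swap_image_range_prod, range_append_prod] at this
        refine ⟨_, (finite_range _).union (finite_range _), subset_union_left, ?_, this⟩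
        rw [← hd]
        rintro _ ⟨i, rfl⟩
        exact ⟨_, Or.inr ⟨i, rfl⟩, rfl⟩
    · intro h
      refine ⟨atomic.1 h.partialIso, fun β hβ m d => ?_⟩
      obtain ⟨l, rfl⟩ := Ordinal.lt_omega0.1 (hβ.trans (Ordinal.natCast_lt_omega0 n))
      have hl : l < n := by exact_mod_cast hβ
      cases n with
      | zero => exact absurd hl (Nat.not_lt_zero _)
      | succ n =>
        obtain ⟨t, -, h1, h2, h3⟩ := h (range d) (finite_range d)
        have : ∀ i, ∃ a, (a, d i) ∈ t := fun i => by
          obtain ⟨p, hp, hpd⟩ := h2 (mem_range_self i)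
          exact ⟨p.1, by rw [← hpd]; exact hp⟩
        choose c hc using this
        refine ⟨c, (ih l hl _ _).2 ?_⟩
        have h4 := ((h3.of_le (Nat.lt_succ_iff.1 hl)).mono
          (union_subset h1 (range_subset_iff.2 hc))).swap
        rwa [← range_append_prod, swap_image_range_prod] at h4

end Tuples

/-! ### The relations at natural levels -/

section Relations

variable {A : Type u} {B : Type v} {X : Type w} {Y : Type x} [LinearOrder A] [LinearOrder B]
  [LinearOrder X] [LinearOrder Y]

/-- `A ≤_n B` for a natural number `n`. -/
def Le (n : ℕ) (A : Type u) (B : Type v) [LinearOrder A] [LinearOrder B] : Prop :=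
  Bf n true (∅ : Set (A × B))

/-- Some finite tuple of `A` answers, at level `n`, a tuple that enumerates a set containing `s`. -/
def Cov (n : ℕ) (A : Type u) (B : Type v) [LinearOrder A] [LinearOrder B] (s : Set B) : Prop :=
  ∃ r : Set (A × B), r.Finite ∧ s ⊆ Prod.snd '' r ∧ Bf n false r

theorem le_succ_iff {n : ℕ} : Le (n + 1) A B ↔ ∀ s : Set B, s.Finite → Cov n A B s := by
  simp [Le, Cov, Bf]

theorem Le.bf_false {n : ℕ} (h : Le n B A) : Bf n false (∅ : Set (A × B)) := by
  simpa using Bf.swap h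

theorem Le.cov {n : ℕ} {s : Set B} (h : Le n B A) (hs : s = ∅) : Cov n A B s :=
  ⟨∅, finite_empty, by simp [hs], h.bf_false⟩

/-- The main tool for constructing answers: decompose both orderings in parallel, copy the summands
that contain challenged points, and compare the untouched ones by `Le` in the reverse direction
(`Le.cov`). -/
theorem Cov.sum {n : ℕ} {s : Set (B ⊕ₗ Y)} (h : Cov n A B ((fun b => toLex (Sum.inl b)) ⁻¹' s))
    (h' : Cov n X Y ((fun b => toLex (Sum.inr b)) ⁻¹' s)) : Cov n (A ⊕ₗ X) (B ⊕ₗ Y) s := by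
  obtain ⟨r, hr, h1, h2⟩ := h
  obtain ⟨t, ht, h1', h2'⟩ := h'
  refine ⟨_, (hr.image _).union (ht.image _), fun y hy => ?_, h2.sum h2'⟩
  rcases y with y | y
  · obtain ⟨p, hp, rfl⟩ := h1 hy
    exact ⟨_, Or.inl (mem_image_of_mem _ hp), rfl⟩
  · obtain ⟨p, hp, rfl⟩ := h1' hy
    exact ⟨_, Or.inr (mem_image_of_mem _ hp), rfl⟩

theorem Cov.map {n : ℕ} {s : Set Y} (f : A ≃o X) (g : B ≃o Y) (h : Cov n A B (g ⁻¹' s)) :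
    Cov n X Y s := by
  obtain ⟨r, hr, h1, h2⟩ := h
  refine ⟨_, hr.image _, fun y hy => ?_, h2.map_orderIso f g⟩
  obtain ⟨p, hp, hpy⟩ := h1 (show g.symm y ∈ g ⁻¹' s by simpa using hy)
  exact ⟨_, mem_image_of_mem _ hp, by simp [hpy]⟩

theorem bf_diagonal {n : ℕ} {d : Bool} {s : Set A} (hs : s.Finite) :
    Bf n d ((fun a => (a, a)) '' s) := by
  induction n generalizing d s with
  | zero =>
    rintro _ ⟨a, -, rfl⟩ _ ⟨b, -, rfl⟩
    rfl
  | succ n ih =>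
    cases d <;>
    · intro t ht
      exact ⟨_, (hs.union ht).image _, image_mono subset_union_left, by simp [image_image],
        ih (hs.union ht)⟩

theorem Cov.refl {n : ℕ} {s : Set A} (hs : s.Finite) : Cov n A A s :=
  ⟨_, hs.image _, by simp [image_image], bf_diagonal hs⟩

theorem Le.refl (n : ℕ) (A : Type u) [LinearOrder A] : Le n A A := by
  simpa [Le] using bf_diagonal (n := n) (d := true) (finite_empty (α := A))

theorem Le.map {n : ℕ} (f : A ≃o X) (g : B ≃o Y) (h : Le n A B) : Le n X Y := by
  simpa [Le] using Bf.map_orderIso h f g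

theorem Le.of_iso {n : ℕ} (f : A ≃o B) : Le n A B :=
  (Le.refl n A).map (OrderIso.refl A) f

theorem Le.dual {n : ℕ} (h : Le n A B) : Le n Aᵒᵈ Bᵒᵈ := by
  simpa [Le] using Bf.dual h

theorem Le.sum {n : ℕ} (h : Le n A B) (h' : Le n X Y) : Le n (A ⊕ₗ X) (B ⊕ₗ Y) := by
  simpa [Le, sumRel] using Bf.sum h h'

theorem Le.of_succ {n : ℕ} (h : Le (n + 1) A B) : Le n A B := Bf.of_succ h

/-- Play the empty tuple: the roles of the orderings are exchanged and one level is lost. -/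
theorem Le.symm_of_succ {n : ℕ} (h : Le (n + 1) A B) : Le n B A := by
  obtain ⟨r, -, -, h⟩ := le_succ_iff.1 h ∅ finite_empty
  simpa [Le] using (h.mono (empty_subset r)).swap

theorem nonempty_orderIso_fin_of_encard {A : Type u} [LinearOrder A] {s : Set A} {l : ℕ}
    (h : s.encard = l) : Nonempty (s ≃o Fin l) := by
  have := (finite_of_encard_eq_coe h).fintype
  refine ⟨(Fintype.orderIsoFinOfCardEq s ?_).symm⟩
  rw [← Nat.card_eq_fintype_card, Nat.card_coe_set_eq, ncard_def, h]
  rfl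

/-- Level one compares sizes. -/
theorem le_one_of_encard_le (h : (univ : Set B).encard ≤ (univ : Set A).encard) : Le 1 A B := by
  intro s hs
  have hk : s.encard = (s.ncard : ℕ∞) := by rw [hs.cast_ncard_eq]
  obtain ⟨t, -, ht⟩ := exists_subset_encard_eq ((encard_le_encard (subset_univ s)).trans h)
  obtain ⟨e⟩ := nonempty_orderIso_fin_of_encard hk
  obtain ⟨f⟩ := nonempty_orderIso_fin_of_encard (ht.trans hk)
  refine ⟨range fun i => ((f.symm i : A), (e.symm i : B)), finite_range _, empty_subset _,
    fun b hb => ⟨_, ⟨e ⟨b, hb⟩, rfl⟩, by simp⟩, ?_⟩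
  rintro _ ⟨i, rfl⟩ _ ⟨j, rfl⟩
  simp

theorem le_one_of_infinite [Infinite A] : Le 1 A B :=
  le_one_of_encard_le (by simp [Set.infinite_univ.encard_eq])

theorem Le.encard_univ_eq (h : Le 2 A B) : (univ : Set A).encard = (univ : Set B).encard :=
  le_antisymm (linked_univ.encard_le_of_bf_true h.symm_of_succ)
    (linked_univ.encard_le_of_bf_true h.of_succ)

/-- A finite ordering answers any enumeration of its own elements at level one. -/
theorem cov_one_of_orderIso {s : Set B} (hs : s.Finite) (e : A ≃o s) : Cov 1 A B s := by
  have := hs.to_subtype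
  have : Finite A := Finite.of_equiv _ e.symm.toEquiv
  have hr : (range fun a => (a, (e a : B))).Finite := finite_range _
  refine ⟨range fun a => (a, (e a : B)), hr, fun b hb => ?_, fun t _ => ⟨_, hr, le_rfl, ?_, ?_⟩⟩
  · exact ⟨_, ⟨e.symm ⟨b, hb⟩, rfl⟩, by simp⟩
  · intro a _
    exact ⟨_, ⟨a, rfl⟩, rfl⟩
  · rintro _ ⟨a, rfl⟩ _ ⟨b, rfl⟩
    simp

end Relations

/-! ### Decomposing an ordering as an ordered sum -/

section Splitting

variable {A : Type u} [LinearOrder A]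

/-- An ordered sum decomposition given by two embeddings. -/
noncomputable def sumOrderIso {B : Type v} {C : Type w} [LinearOrder B] [LinearOrder C]
    (f : A ↪o C) (g : B ↪o C) (h : ∀ a b, f a < g b) (hs : ∀ c, c ∈ range f ∨ c ∈ range g) :
    A ⊕ₗ B ≃o C :=
  StrictMono.orderIsoOfSurjective (fun x => Sum.elim f g (ofLex x))
    (by
      intro x y hxy
      obtain ⟨x | x, rfl⟩ := toLex.surjective x <;> obtain ⟨y | y, rfl⟩ := toLex.surjective y
      · simpa using hxy
      · exact h x y
      · simp at hxy
      · simpa using hxy)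
    (by
      intro c
      rcases hs c with ⟨a, rfl⟩ | ⟨b, rfl⟩
      · exact ⟨toLex (Sum.inl a), rfl⟩
      · exact ⟨toLex (Sum.inr b), rfl⟩)

/-- A sum of finite chains. -/
noncomputable def sumFin (k l : ℕ) : Fin k ⊕ₗ Fin l ≃o Fin (k + l) :=
  sumOrderIso (Fin.castAddOrderEmb l) (Fin.natAddOrderEmb k)
    (fun a b => by simp [Fin.lt_def]; lia)
    (fun c => Fin.addCases (fun i => Or.inl ⟨i, rfl⟩) (fun i => Or.inr ⟨i, rfl⟩) c)

/-- A final segment `[a, ∞)` is the sum of `[a, b]` and `(b, ∞)`. -/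
noncomputable def sumIccIoi {a b : A} (h : a ≤ b) : Icc a b ⊕ₗ Ioi b ≃o Ici a :=
  sumOrderIso
    (OrderEmbedding.ofStrictMono (fun x : Icc a b => (⟨x, x.2.1⟩ : Ici a)) fun _ _ hxy => hxy)
    (OrderEmbedding.ofStrictMono (fun x : Ioi b => (⟨x, h.trans (le_of_lt x.2)⟩ : Ici a))
      fun _ _ hxy => hxy)
    (fun x y => show x.1 < y.1 from lt_of_le_of_lt x.2.2 y.2)
    (fun y => (le_or_gt y.1 b).imp (fun hy => ⟨⟨y, y.2, hy⟩, rfl⟩) fun hy => ⟨⟨y, hy⟩, rfl⟩)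

/-- The ordering is the sum of the part below `a`, the interval `[a, b]` and the part above `b`. -/
noncomputable def splitIcc {a b : A} (h : a ≤ b) : Iio a ⊕ₗ (Icc a b ⊕ₗ Ioi b) ≃o A :=
  sumOrderIso (OrderEmbedding.subtype (· ∈ Iio a))
    ((sumIccIoi h).toOrderEmbedding.trans (OrderEmbedding.subtype (· ∈ Ici a)))
    (fun x y => lt_of_lt_of_le x.2 (sumIccIoi h y).2)
    (fun c => (lt_or_ge c a).imp (fun hc => ⟨⟨c, hc⟩, rfl⟩)
      fun hc => ⟨(sumIccIoi h).symm ⟨c, hc⟩, by simp⟩)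

end Splitting

/-! ### Runs of successive elements and their invariance -/

section Runs

variable {A : Type u} {B : Type v} {X : Type w} {Y : Type x} [LinearOrder A] [LinearOrder B]
  [LinearOrder X] [LinearOrder Y]

/-- The ordering begins with `l` successive elements. -/
def HasInit (A : Type u) [LinearOrder A] (l : ℕ) : Prop :=
  l = 0 ∨ ∃ a : A, (Iic a).encard = l

/-- The first elements of the runs of `N` successive elements. -/
def runStarts (A : Type u) [LinearOrder A] (N : ℕ) : Set A :=
  {a | ∃ b, a ≤ b ∧ (Icc a b).encard = N}

/-- Every finite interval has at most `N` elements. -/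
def RunsLe (A : Type u) [LinearOrder A] (N : ℕ) : Prop :=
  runStarts A (N + 1) = ∅

/-- Enumerate the finite initial segment of `B`. The partial isomorphism makes the corresponding
segment of `A` at least as large, and the remaining level makes it no larger. -/
theorem HasInit.of_le {l : ℕ} (h : Le 2 A B) (H : HasInit B l) : HasInit A l := by
  refine H.imp_right ?_
  rintro ⟨b, hb⟩
  obtain ⟨r, -, h1, h2⟩ := le_succ_iff.1 h (Iic b) (finite_of_encard_eq_coe hb)
  obtain ⟨p, hp, rfl⟩ := h1 (mem_Iic.2 le_rfl)
  exact ⟨p.1, (le_antisymm ((linked_Iic hp).encard_le_of_bf_false h2)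
    ((linked_Iic hp).encard_le h2.partialIso le_rfl h1)).trans hb⟩

theorem encard_Icc_eq {r : Set (A × B)} (h : Bf 1 false r) {p q : A × B} (hp : p ∈ r)
    (hq : q ∈ r) (H : Icc p.2 q.2 ⊆ Prod.snd '' r) :
    (Icc p.1 q.1).encard = (Icc p.2 q.2).encard :=
  le_antisymm ((linked_Icc hp hq).encard_le_of_bf_false h)
    ((linked_Icc hp hq).encard_le h.partialIso le_rfl H)

/-- Challenge with finitely many complete runs at once. Each is answered by a run of the same
length, and distinct starting points get distinct answers. -/
theorem encard_runStarts_le (h : Le 2 A B) (N : ℕ) :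
    (runStarts B N).encard ≤ (runStarts A N).encard := by
  refine encard_le_of_forall_finite fun s hs hf => ?_
  have hs' : ∀ b ∈ s, ∃ c, b ≤ c ∧ (Icc b c).encard = N := fun b hb => hs hb
  choose! e he using hs'
  obtain ⟨r, -, h1, h2⟩ := le_succ_iff.1 h (⋃ b ∈ s, Icc b (e b))
    (hf.biUnion fun b hb => finite_of_encard_eq_coe (he b hb).2)
  refine encard_le_of_rel r (fun b hb => ?_) fun a b c hb hc => (h2.partialIso.eq_iff hb hc).1 rfl
  have hsub := (subset_biUnion_of_mem (u := fun b => Icc b (e b)) hb).trans h1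
  obtain ⟨p, hp, hpb⟩ := hsub ⟨le_rfl, (he b hb).1⟩
  obtain ⟨q, hq, hqb⟩ := hsub ⟨(he b hb).1, le_rfl⟩
  refine ⟨p.1, ⟨q.1, ?_, ?_⟩, hpb ▸ hp⟩
  · rw [h2.partialIso p hp q hq, hpb, hqb]
    exact (he b hb).1
  · rw [encard_Icc_eq h2 hp hq (by rw [hpb, hqb]; exact hsub), hpb, hqb]
    exact (he b hb).2

theorem RunsLe.of_le {N : ℕ} (h : Le 2 A B) (H : RunsLe A N) : RunsLe B N := by
  have := encard_runStarts_le h (N + 1)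
  rw [H, encard_empty, nonpos_iff_eq_zero, encard_eq_zero] at this
  exact this

/-- Take the least `c` for which `[a, c]` has at least `N + 1` elements. If `[a, c)` had more than
`N` elements, its greatest element would be a smaller choice. -/
theorem exists_encard_Icc_eq {a b : A} {N : ℕ} (hf : (Icc a b).Finite)
    (hN : ((N + 1 : ℕ) : ℕ∞) ≤ (Icc a b).encard) :
    ∃ c, a ≤ c ∧ c ≤ b ∧ (Icc a c).encard = (N + 1 : ℕ) := by
  have hmono : ∀ c ∈ Icc a b, Icc a c ⊆ Icc a b := fun c hc => Icc_subset_Icc_right hc.2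
  let s : Set A := {c ∈ Icc a b | ((N + 1 : ℕ) : ℕ∞) ≤ (Icc a c).encard}
  have hab : a ≤ b := by
    by_contra h
    rw [Icc_eq_empty h, encard_empty] at hN
    simp at hN
  obtain ⟨c, hc⟩ := (hf.subset (sep_subset _ _)).exists_minimal (s := s)
    ⟨b, ⟨hab, le_rfl⟩, hN⟩
  refine ⟨c, hc.1.1.1, hc.1.1.2, le_antisymm ?_ hc.1.2⟩
  have hIco : Icc a c = insert c (Ico a c) := (Ico_insert_right hc.1.1.1).symm
  rw [hIco, encard_insert_of_notMem (by simp)]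
  push_cast
  refine add_le_add_left ?_ 1
  rcases (Ico a c).eq_empty_or_nonempty with h0 | hne
  · simp [h0]
  have hfin : (Ico a c).Finite := (hf.subset (hmono c hc.1.1)).subset Ico_subset_Icc_self
  obtain ⟨d, hd⟩ := hfin.exists_maximal hne
  have hsub : Ico a c ⊆ Icc a d := fun y hy => ⟨hy.1, not_lt.1 fun h => h.not_ge (hd.2 hy h.le)⟩
  refine (encard_le_encard hsub).trans ?_
  by_contra h
  have hds : d ∈ s := ⟨⟨hd.1.1, hd.1.2.le.trans hc.1.1.2⟩, by
    push_cast
    exact Order.add_one_le_of_lt (not_le.1 h)⟩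
  exact hd.1.2.not_ge (hc.2 hds hd.1.2.le)

theorem RunsLe.encard_le {N : ℕ} (h : RunsLe A N) {a b : A} (hf : (Icc a b).Finite) :
    (Icc a b).encard ≤ N := by
  by_contra H
  obtain ⟨c, hc, -, hc'⟩ := exists_encard_Icc_eq (N := N) hf (by
    push_cast
    exact Order.add_one_le_of_lt (not_le.1 H))
  exact eq_empty_iff_forall_notMem.1 h a ⟨c, hc, hc'⟩

theorem runsLe_of_encard_le {N : ℕ} (h : ∀ a b : A, (Icc a b).Finite → (Icc a b).encard ≤ N) :
    RunsLe A N := by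
  refine eq_empty_iff_forall_notMem.2 ?_
  rintro a ⟨b, -, hab⟩
  have := h a b (finite_of_encard_eq_coe hab)
  rw [hab] at this
  exact absurd (Nat.cast_le.1 this) (by simp)

theorem RunsLe.mono {N M : ℕ} (hNM : N ≤ M) (h : RunsLe A N) : RunsLe A M :=
  runsLe_of_encard_le fun _ _ hf => (h.encard_le hf).trans (by exact_mod_cast hNM)

theorem runsLe_iff_le {N M : ℕ} (h : RunsLe A (N + 1)) (h' : (runStarts A (N + 1)).Nonempty) :
    RunsLe A M ↔ N + 1 ≤ M := by
  refine ⟨fun H => ?_, fun H => h.mono H⟩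
  obtain ⟨a, b, -, hab⟩ := h'
  have := H.encard_le (finite_of_encard_eq_coe hab)
  rw [hab] at this
  exact_mod_cast this

theorem image_Icc_of_ordConnected (f : X ↪o A) (hf : (range f).OrdConnected) (x y : X) :
    f '' Icc x y = Icc (f x) (f y) := by
  ext c
  constructor
  · rintro ⟨z, hz, rfl⟩
    simpa using hz
  · intro hc
    obtain ⟨z, rfl⟩ := hf.out ⟨x, rfl⟩ ⟨y, rfl⟩ hc
    exact ⟨z, by simpa using hc, rfl⟩

theorem encard_Icc_of_ordConnected (f : X ↪o A) (hf : (range f).OrdConnected) (x y : X) :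
    (Icc (f x) (f y)).encard = (Icc x y).encard := by
  rw [← image_Icc_of_ordConnected f hf, f.injective.encard_image]

theorem image_runStarts_subset (f : X ↪o A) (hf : (range f).OrdConnected) (N : ℕ) :
    f '' runStarts X N ⊆ runStarts A N := by
  rintro _ ⟨x, ⟨y, hxy, h⟩, rfl⟩
  exact ⟨f y, by simpa using hxy, by rwa [encard_Icc_of_ordConnected f hf]⟩

theorem RunsLe.of_ordConnected {N : ℕ} (h : RunsLe A N) (f : X ↪o A)
    (hf : (range f).OrdConnected) : RunsLe X N := by
  have := image_runStarts_subset f hf (N + 1)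
  rw [h, subset_empty_iff, image_eq_empty] at this
  exact this

/-- The embedding of the first summand of an ordered sum. -/
def inlEmb (X : Type w) (Y : Type x) [LinearOrder X] [LinearOrder Y] : X ↪o X ⊕ₗ Y :=
  OrderEmbedding.ofStrictMono (fun a => toLex (Sum.inl a)) Sum.Lex.inl_strictMono

/-- The embedding of the second summand of an ordered sum. -/
def inrEmb (X : Type w) (Y : Type x) [LinearOrder X] [LinearOrder Y] : Y ↪o X ⊕ₗ Y :=
  OrderEmbedding.ofStrictMono (fun a => toLex (Sum.inr a)) Sum.Lex.inr_strictMono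

theorem ordConnected_range_inlEmb : (range (inlEmb X Y)).OrdConnected := by
  refine ⟨?_⟩
  rintro _ ⟨x, rfl⟩ _ ⟨y, rfl⟩ z hz
  obtain ⟨z | z, rfl⟩ := toLex.surjective z
  · exact ⟨z, rfl⟩
  · exact absurd hz.2 (by simp [inlEmb])

theorem ordConnected_range_inrEmb : (range (inrEmb X Y)).OrdConnected := by
  refine ⟨?_⟩
  rintro _ ⟨x, rfl⟩ _ ⟨y, rfl⟩ z hz
  obtain ⟨z | z, rfl⟩ := toLex.surjective z
  · exact absurd hz.1 (by simp [inrEmb])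
  · exact ⟨z, rfl⟩

theorem infinite_Icc_of_noMaxOrder [NoMaxOrder X] (x : X) (y : Y) :
    (Icc (inlEmb X Y x) (inrEmb X Y y)).Infinite := by
  refine ((Ici_infinite x).image (inlEmb X Y).injective.injOn).mono ?_
  rintro _ ⟨z, hz, rfl⟩
  exact ⟨by simpa using hz, by simp [inlEmb, inrEmb]⟩

theorem infinite_Icc_of_noMinOrder [NoMinOrder Y] (x : X) (y : Y) :
    (Icc (inlEmb X Y x) (inrEmb X Y y)).Infinite := by
  refine ((Iic_infinite y).image (inrEmb X Y).injective.injOn).mono ?_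
  rintro _ ⟨z, hz, rfl⟩
  exact ⟨by simp [inlEmb, inrEmb], by simpa using hz⟩

/-- The hypothesis on the junction makes every interval that crosses it infinite, so a run lies in
one summand. -/
theorem runStarts_sum (h : NoMaxOrder X ∨ NoMinOrder Y) (N : ℕ) :
    runStarts (X ⊕ₗ Y) N = inlEmb X Y '' runStarts X N ∪ inrEmb X Y '' runStarts Y N := by
  refine subset_antisymm ?_ (union_subset (image_runStarts_subset _ ordConnected_range_inlEmb N)
    (image_runStarts_subset _ ordConnected_range_inrEmb N))
  rintro c ⟨d, hcd, hN⟩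
  obtain ⟨c | c, rfl⟩ := toLex.surjective c <;> obtain ⟨d | d, rfl⟩ := toLex.surjective d
  · refine Or.inl ⟨c, ⟨d, by simpa using hcd, ?_⟩, rfl⟩
    rw [← hN, ← encard_Icc_of_ordConnected (inlEmb X Y) ordConnected_range_inlEmb]
    rfl
  · have hf : (Icc (inlEmb X Y c) (inrEmb X Y d)).Finite := finite_of_encard_eq_coe hN
    rcases h with h | h
    · exact absurd hf (infinite_Icc_of_noMaxOrder c d)
    · exact absurd hf (infinite_Icc_of_noMinOrder c d)
  · simp at hcd
  · refine Or.inr ⟨c, ⟨d, by simpa using hcd, ?_⟩, rfl⟩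
    rw [← hN, ← encard_Icc_of_ordConnected (inrEmb X Y) ordConnected_range_inrEmb]
    rfl

theorem RunsLe.sum {N : ℕ} (hX : RunsLe X N) (hY : RunsLe Y N)
    (h : NoMaxOrder X ∨ NoMinOrder Y) : RunsLe (X ⊕ₗ Y) N := by
  rw [RunsLe, runStarts_sum h, hX, hY]
  simp

theorem runsLe_fin {n N : ℕ} (h : n ≤ N) : RunsLe (Fin n) N := by
  refine runsLe_of_encard_le fun a b _ => ?_
  refine (encard_le_encard (subset_univ _)).trans ?_
  simpa using h

theorem mk_le_mk_lex {E : Type u} {F : Type v} [LinearOrder E] [LinearOrder F] {p q : E} {i j : F} :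
    (toLex (p, i) : E ×ₗ F) ≤ toLex (q, j) ↔ p < q ∨ p = q ∧ i ≤ j := by
  rw [Prod.Lex.toLex_le_toLex]

/-- The copy of `F` that replaces the point `q`. -/
def fiberEmb {E : Type u} (F : Type v) [LinearOrder E] [LinearOrder F] (q : E) : F ↪o E ×ₗ F :=
  OrderEmbedding.ofStrictMono (fun i => toLex (q, i)) fun i j h => by
    simpa [Prod.Lex.toLex_lt_toLex] using h

theorem ordConnected_range_fiberEmb {E : Type u} (F : Type v) [LinearOrder E] [LinearOrder F]
    (q : E) : (range (fiberEmb F q)).OrdConnected := by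
  refine ⟨?_⟩
  rintro _ ⟨i, rfl⟩ _ ⟨j, rfl⟩ z hz
  obtain ⟨⟨p, k⟩, rfl⟩ := toLex.surjective z
  have h1 := mk_le_mk_lex.1 hz.1
  have h2 := mk_le_mk_lex.1 hz.2
  have : p = q := by
    rcases h1 with h1 | h1
    · rcases h2 with h2 | h2
      · exact absurd h2 h1.not_gt
      · exact h2.1
    · exact h1.1.symm
  subst this
  exact ⟨k, rfl⟩

theorem infinite_Icc_prod {E : Type u} {F : Type v} [LinearOrder E] [LinearOrder F]
    [DenselyOrdered E] {p q : E} (h : p < q) (i j : F) :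
    (Icc (toLex (p, i) : E ×ₗ F) (toLex (q, j))).Infinite := by
  refine ((Ioo_infinite h).image (f := fun s => (toLex (s, i) : E ×ₗ F))
    fun s _ t _ hst => by simpa using hst).mono ?_
  rintro _ ⟨z, hz, rfl⟩
  exact ⟨mk_le_mk_lex.2 (Or.inl hz.1), mk_le_mk_lex.2 (Or.inl hz.2)⟩

theorem encard_Icc_prod_le {E : Type u} [LinearOrder E] [DenselyOrdered E] {m : ℕ}
    {a b : E ×ₗ Fin m} (h : (Icc a b).Finite) : (Icc a b).encard ≤ m := by
  obtain ⟨⟨p, i⟩, rfl⟩ := toLex.surjective a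
  obtain ⟨⟨q, j⟩, rfl⟩ := toLex.surjective b
  rcases lt_trichotomy p q with hpq | rfl | hpq
  · exact absurd h (infinite_Icc_prod hpq i j)
  · refine (encard_Icc_of_ordConnected _ (ordConnected_range_fiberEmb (Fin m) p) i j).trans_le ?_
    refine (encard_le_encard (subset_univ _)).trans ?_
    simp
  · rw [Icc_eq_empty, encard_empty]
    · exact zero_le
    · rw [mk_le_mk_lex]
      rintro (h | h)
      · exact h.not_gt hpq
      · exact hpq.ne' h.1

theorem runsLe_prod {E : Type u} [LinearOrder E] [DenselyOrdered E] (m : ℕ) :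
    RunsLe (E ×ₗ Fin m) m :=
  runsLe_of_encard_le fun _ _ => encard_Icc_prod_le

theorem infinite_runStarts_prod {E : Type u} [LinearOrder E] [Infinite E] (m : ℕ) :
    (runStarts (E ×ₗ Fin (m + 1)) (m + 1)).Infinite := by
  refine (infinite_univ.image (f := fun q : E => (toLex (q, 0) : E ×ₗ Fin (m + 1)))
    fun s _ t _ hst => by simpa using hst).mono ?_
  rintro _ ⟨q, -, rfl⟩
  refine ⟨fiberEmb _ q (Fin.last m), mk_le_mk_lex.2 (Or.inr ⟨rfl, Fin.zero_le _⟩), ?_⟩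
  refine (encard_Icc_of_ordConnected _ (ordConnected_range_fiberEmb (Fin (m + 1)) q) 0
    (Fin.last m)).trans ?_
  have : Icc (0 : Fin (m + 1)) (Fin.last m) = univ :=
    eq_univ_of_forall fun i => ⟨Fin.zero_le _, Fin.le_last _⟩
  rw [this]
  simp

end Runs

/-! ### Maximal runs at the two ends -/

section Ends

variable {A : Type u} {B : Type v} {X : Type w} {Y : Type x} [LinearOrder A] [LinearOrder B]
  [LinearOrder X] [LinearOrder Y]

theorem noMinOrder_of_iso (e : A ≃o B) [NoMinOrder A] : NoMinOrder B where
  exists_lt b := by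
    obtain ⟨a, ha⟩ := exists_lt (e.symm b)
    exact ⟨e a, by simpa using e.lt_iff_lt.2 ha⟩

theorem noMaxOrder_of_iso (e : A ≃o B) [NoMaxOrder A] : NoMaxOrder B where
  exists_gt b := by
    obtain ⟨a, ha⟩ := exists_gt (e.symm b)
    exact ⟨e a, by simpa using e.lt_iff_lt.2 ha⟩

theorem noMaxOrder_right [NoMaxOrder (X ⊕ₗ Y)] : NoMaxOrder Y where
  exists_gt y := by
    obtain ⟨z, hz⟩ := exists_gt (inrEmb X Y y)
    obtain ⟨z | z, rfl⟩ := toLex.surjective z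
    · exact absurd hz (by simp [inrEmb])
    · exact ⟨z, by simpa [inrEmb] using hz⟩

theorem noMinOrder_left [NoMinOrder (X ⊕ₗ Y)] : NoMinOrder X where
  exists_lt y := by
    obtain ⟨z, hz⟩ := exists_lt (inlEmb X Y y)
    obtain ⟨z | z, rfl⟩ := toLex.surjective z
    · exact ⟨z, by simpa [inlEmb] using hz⟩
    · exact absurd hz (by simp [inlEmb])

theorem infinite_right {X : Type w} {Y : Type x} [Infinite (X ⊕ₗ Y)] [Finite X] : Infinite Y := by
  by_contra h
  rw [not_infinite_iff_finite] at h
  exact not_finite_iff_infinite.2 (inferInstance : Infinite (X ⊕ₗ Y))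
    (inferInstanceAs (Finite (X ⊕ Y)))

theorem infinite_left {X : Type w} {Y : Type x} [Infinite (X ⊕ₗ Y)] [Finite Y] : Infinite X := by
  by_contra h
  rw [not_infinite_iff_finite] at h
  exact not_finite_iff_infinite.2 (inferInstance : Infinite (X ⊕ₗ Y))
    (inferInstanceAs (Finite (X ⊕ Y)))

theorem hasInit_zero : HasInit A 0 := Or.inl rfl

theorem HasInit.eq_zero [NoMinOrder A] {l : ℕ} (h : HasInit A l) : l = 0 := by
  rcases h with h | ⟨a, ha⟩
  · exact h
  · exact absurd (finite_of_encard_eq_coe ha) (Iic_infinite a)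

theorem HasInit.of_iso (e : A ≃o B) {l : ℕ} (h : HasInit A l) : HasInit B l :=
  HasInit.of_le (Le.of_iso e.symm) h

theorem encard_Iic_inl (x : X) : (Iic (inlEmb X Y x)).encard = (Iic x).encard := by
  rw [← (inlEmb X Y).injective.encard_image]
  congr 1
  ext z
  constructor
  · intro hz
    obtain ⟨z | z, rfl⟩ := toLex.surjective z
    · exact ⟨z, by simpa [inlEmb] using hz, rfl⟩
    · exact absurd hz (by simp [inlEmb])
  · rintro ⟨z, hz, rfl⟩
    simpa using hz

theorem encard_Iic_inr (y : Y) :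
    (Iic (inrEmb X Y y)).encard = (univ : Set X).encard + (Iic y).encard := by
  rw [← (inlEmb X Y).injective.encard_image, ← (inrEmb X Y).injective.encard_image,
    ← encard_union_eq]
  · congr 1
    ext z
    obtain ⟨z | z, rfl⟩ := toLex.surjective z <;> simp [inlEmb, inrEmb]
  · rw [disjoint_left]
    rintro _ ⟨x, -, rfl⟩ ⟨y, -, h⟩
    simp [inlEmb, inrEmb] at h

theorem HasInit.sum_left {l : ℕ} (h : HasInit X l) : HasInit (X ⊕ₗ Y) l := by
  refine h.imp_right ?_
  rintro ⟨x, hx⟩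
  exact ⟨inlEmb X Y x, by rwa [encard_Iic_inl]⟩

/-- A finite initial segment cannot reach the second summand past an infinite first one. -/
theorem HasInit.of_sum [Infinite X] {l : ℕ} (h : HasInit (X ⊕ₗ Y) l) : HasInit X l := by
  refine h.imp_right ?_
  rintro ⟨z, hz⟩
  obtain ⟨z | z, rfl⟩ := toLex.surjective z
  · exact ⟨z, by rw [← hz, ← encard_Iic_inl (Y := Y)]; rfl⟩
  · have : (Iic (inrEmb X Y z)).encard = l := hz
    rw [encard_Iic_inr, infinite_univ.encard_eq, top_add] at this
    simp at this

theorem hasInit_fin {n l : ℕ} (h : l ≤ n) : HasInit (Fin n) l := by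
  cases l with
  | zero => exact Or.inl rfl
  | succ l =>
    refine Or.inr ⟨⟨l, h⟩, ?_⟩
    rw [encard_eq_coe_toFinset_card]
    simp

theorem hasInit_fin_sum_iff [NoMinOrder Y] {n l : ℕ} : HasInit (Fin n ⊕ₗ Y) l ↔ l ≤ n := by
  refine ⟨fun h => ?_, fun h => (hasInit_fin h).sum_left⟩
  rcases h with rfl | ⟨z, hz⟩
  · exact Nat.zero_le _
  obtain ⟨z | z, rfl⟩ := toLex.surjective z
  · have : (Iic (inlEmb (Fin n) Y z)).encard = l := hz
    rw [encard_Iic_inl] at this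
    have h2 := encard_le_encard (subset_univ (Iic z))
    rw [this] at h2
    simpa using h2
  · have : (Iic (inrEmb (Fin n) Y z)).encard = l := hz
    rw [encard_Iic_inr, (Iic_infinite z).encard_eq, add_top] at this
    simp at this

theorem HasInit.exists_iso {l : ℕ} (h : HasInit A l) :
    ∃ (Z : Type u) (_ : LinearOrder Z), Nonempty (A ≃o Fin l ⊕ₗ Z) := by
  rcases h with rfl | ⟨a, ha⟩
  · exact ⟨A, inferInstance, ⟨(OrderIso.emptySumLex (β := Fin 0)).symm⟩⟩
  · obtain ⟨e⟩ := nonempty_orderIso_fin_of_encard ha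
    exact ⟨Ioi a, inferInstance,
      ⟨(OrderIso.sumLexIicIoi a).symm.trans (e.sumLexCongr (OrderIso.refl _))⟩⟩

/-- The maximal initial segment of successive elements has size `c`, or is infinite. -/
def InitIs (A : Type u) [LinearOrder A] (c : ℕ∞) : Prop :=
  ∀ l : ℕ, HasInit A l ↔ (l : ℕ∞) ≤ c

theorem InitIs.unique {c d : ℕ∞} (h : InitIs A c) (h' : InitIs A d) : c = d :=
  le_antisymm (ENat.forall_natCast_le_iff_le.1 fun l hl => (h' l).1 ((h l).2 hl))
    (ENat.forall_natCast_le_iff_le.1 fun l hl => (h l).1 ((h' l).2 hl))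

theorem InitIs.of_iso {c : ℕ∞} (e : A ≃o B) (h : InitIs A c) : InitIs B c :=
  fun l => ⟨fun H => (h l).1 (H.of_iso e.symm), fun H => ((h l).2 H).of_iso e⟩

/-- The lengths of initial runs are closed downwards, so they are either all natural numbers or
those up to the predecessor of the first failure. -/
theorem exists_initIs (A : Type u) [LinearOrder A] : ∃ c, InitIs A c := by
  have down : ∀ {l m : ℕ}, m ≤ l → HasInit A l → HasInit A m := fun hml h => by
    obtain ⟨Z, _, ⟨e⟩⟩ := h.exists_iso
    exact ((hasInit_fin hml).sum_left).of_iso e.symm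
  by_cases h : ∀ l, HasInit A l
  · exact ⟨⊤, fun l => by simp [h l]⟩
  · classical
    push Not at h
    have h0 : Nat.find h ≠ 0 := fun h0 => by
      have := Nat.find_spec h
      rw [h0] at this
      exact this hasInit_zero
    obtain ⟨k, hk⟩ := Nat.exists_eq_succ_of_ne_zero h0
    refine ⟨k, fun l => ⟨fun H => ?_, fun H => ?_⟩⟩
    · by_contra hl
      have hl : k < l := by simpa using hl
      exact Nat.find_spec h (down (by lia) H)
    · have hl : l ≤ k := by simpa using H
      exact not_not.1 (Nat.find_min h (m := l) (by lia))

theorem initIs_fin_sum [NoMinOrder Y] (n : ℕ) : InitIs (Fin n ⊕ₗ Y) n := fun l => by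
  rw [hasInit_fin_sum_iff]
  simp

/-- A least element of the remainder would prolong the maximal initial run. -/
theorem InitIs.exists_iso {n : ℕ} (h : InitIs A n) :
    ∃ (Z : Type u) (_ : LinearOrder Z), NoMinOrder Z ∧ Nonempty (A ≃o Fin n ⊕ₗ Z) := by
  obtain ⟨Z, _, ⟨e⟩⟩ := ((h n).2 le_rfl).exists_iso
  refine ⟨Z, inferInstance, ⟨fun z => ?_⟩, ⟨e⟩⟩
  by_contra H
  push Not at H
  have h1 : HasInit (Fin n ⊕ₗ Z) (n + 1) := by
    refine Or.inr ⟨inrEmb _ _ z, ?_⟩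
    rw [encard_Iic_inr, show Iic z = {z} from subset_antisymm
      (fun y hy => le_antisymm hy (H y)) (by simp)]
    simp
  have h2 := (h (n + 1)).1 (h1.of_iso e.symm)
  exact absurd (Nat.cast_le.1 h2) (by simp)

/-- The order dual of a sum of two orderings, the second one finite. -/
def dualSumFin (X : Type w) [LinearOrder X] (n : ℕ) : (X ⊕ₗ Fin n)ᵒᵈ ≃o Fin n ⊕ₗ Xᵒᵈ :=
  (OrderIso.sumLexDualAntidistrib X (Fin n)).trans
    (Fin.revOrderIso.sumLexCongr (OrderIso.refl _))

/-- The order dual of a sum of two orderings, the first one finite. -/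
def dualFinSum (n : ℕ) (X : Type w) [LinearOrder X] : (Fin n ⊕ₗ X)ᵒᵈ ≃o Xᵒᵈ ⊕ₗ Fin n :=
  (OrderIso.sumLexDualAntidistrib (Fin n) X).trans
    ((OrderIso.refl _).sumLexCongr Fin.revOrderIso)

theorem InitIs.exists_iso_dual {n : ℕ} (h : InitIs Aᵒᵈ n) :
    ∃ (Z : Type u) (_ : LinearOrder Z), NoMaxOrder Z ∧ Nonempty (A ≃o Z ⊕ₗ Fin n) := by
  obtain ⟨Z, _, _, ⟨e⟩⟩ := h.exists_iso
  exact ⟨Zᵒᵈ, inferInstance, inferInstance,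
    ⟨(OrderIso.dualDual A).trans (e.dual.trans (dualFinSum n Z))⟩⟩

theorem finalIs_sum_fin [NoMaxOrder X] (n : ℕ) : InitIs (X ⊕ₗ Fin n)ᵒᵈ n :=
  (initIs_fin_sum n).of_iso (dualSumFin X n).symm

end Ends

/-! ### Level-two lower bounds for infinite orderings -/

section LevelTwo

variable {C : Type u} {X : Type v} {Y : Type w} [LinearOrder C] [LinearOrder X] [LinearOrder Y]

/-- If `C` is infinite above an upper bound `m` of `s`, then `X` answers `s` by an initial run. -/
theorem cov_one_of_infinite_Ioi {s : Set C} (hs : s.Finite) (hX : HasInit X s.ncard) {m : C}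
    (hm : ∀ y ∈ s, y ≤ m) (hinf : (Ioi m).Infinite) : Cov 1 X C s := by
  obtain ⟨Z, _, ⟨e⟩⟩ := hX.exists_iso
  refine Cov.map e.symm (OrderIso.sumLexIicIoi m) (Cov.sum ?_ ?_)
  · have hcard : ((fun b => toLex (Sum.inl b)) ⁻¹' (OrderIso.sumLexIicIoi m ⁻¹' s)).encard =
        s.ncard := by
      rw [hs.cast_ncard_eq, ← Subtype.val_injective.encard_image]
      congr 1
      ext y
      constructor
      · rintro ⟨z, hz, rfl⟩
        simpa using hz
      · intro hy
        exact ⟨⟨y, hm y hy⟩, by simpa using hy, rfl⟩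
    obtain ⟨f⟩ := nonempty_orderIso_fin_of_encard hcard
    exact cov_one_of_orderIso (finite_of_encard_eq_coe hcard) f.symm
  · have := hinf.to_subtype
    refine le_one_of_infinite.cov (eq_empty_of_forall_notMem fun y hy => ?_)
    have hy : (y : C) ∈ s := by simpa using hy
    exact (hm y hy).not_gt y.2

theorem le_two_of_noMaxOrder [Nonempty C] [NoMaxOrder C] (hX : ∀ n, HasInit X n) : Le 2 X C := by
  refine le_succ_iff.2 fun s hs => ?_
  obtain ⟨m, hm⟩ := hs.bddAbove
  exact cov_one_of_infinite_Ioi hs (hX _) (fun y hy => hm hy) (Ioi_infinite m)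

theorem le_two_of_noMinOrder [Nonempty C] [NoMinOrder C] (hX : ∀ n, HasInit Xᵒᵈ n) : Le 2 X C :=
  (le_two_of_noMaxOrder (C := Cᵒᵈ) hX).dual.map (OrderIso.dualDual X).symm (OrderIso.dualDual C).symm

theorem cov_one_of_finite_Iic [Infinite C] {s : Set C} (hs : s.Finite) (hX : ∀ n, HasInit X n)
    (h : ∀ y ∈ s, (Iic y).Finite) : Cov 1 X C s := by
  rcases s.eq_empty_or_nonempty with rfl | hne
  · exact le_one_of_infinite.cov rfl
  · obtain ⟨m, hm, hmax⟩ := hs.exists_maximal hne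
    refine cov_one_of_infinite_Ioi hs (hX _) (m := m) (fun y hy => ?_) fun hf => ?_
    · exact not_lt.1 fun h => h.not_ge (hmax hy h.le)
    · have := (h m hm).union hf
      rw [Iic_union_Ioi] at this
      exact infinite_univ this

/-- `ω + ω*` is below every infinite ordering at level two. -/
theorem le_two_of_infinite [Infinite C] (hX : ∀ n, HasInit X n)
    (hd : ∀ n, ∃ (Z : Type v) (_ : LinearOrder Z), Nonempty (X ≃o Z ⊕ₗ Fin n) ∧
      ∀ m, HasInit Z m) : Le 2 X C := by
  refine le_succ_iff.2 fun s hs => ?_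
  by_cases h : ∀ y ∈ s, (Iic y).Finite
  · exact cov_one_of_finite_Iic hs hX h
  push Not at h
  -- Cut at the first challenged point with infinitely many predecessors. The challenged points from
  -- `x` on are answered by the last elements of `X`, those below by its first elements, and the
  -- infinite gap falls just before `x`.
  obtain ⟨x, ⟨hxs, hx⟩, hmin⟩ := (hs.subset (sep_subset s fun y => (Iic y).Infinite)).exists_minimal h
  have hIio : (Iio x).Infinite := fun hf => hx (by
    rw [← Iio_insert]
    exact hf.insert x)
  have := hIio.to_subtype
  have hfin : ((fun b => toLex (Sum.inr b)) ⁻¹' (OrderIso.sumLexIioIci x ⁻¹' s)).Finite := by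
    refine (hs.preimage (f := fun b : Ici x => (b : C)) Subtype.val_injective.injOn).subset ?_
    intro y hy
    simpa using hy
  obtain ⟨Z, _, ⟨e⟩, hZ⟩ := hd _
  refine Cov.map e.symm (OrderIso.sumLexIioIci x) (Cov.sum ?_ ?_)
  · refine cov_one_of_finite_Iic ?_ hZ ?_
    · refine (hs.preimage (f := fun b : Iio x => (b : C)) Subtype.val_injective.injOn).subset ?_
      intro y hy
      simpa using hy
    · intro y hy
      have hy : (y : C) ∈ s := by simpa using hy
      have hf : (Iic (y : C)).Finite := by
        by_contra h
        exact y.2.not_ge (hmin ⟨hy, h⟩ (le_of_lt y.2))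
      exact (hf.preimage (f := fun b : Iio x => (b : C)) Subtype.val_injective.injOn).subset
        fun z hz => hz
  · obtain ⟨f⟩ := nonempty_orderIso_fin_of_encard hfin.cast_ncard_eq.symm
    exact cov_one_of_orderIso hfin f.symm

end LevelTwo

/-! ### Level three for `ω`, `ω + ω*` and `ℤ` -/

section Models

variable {A : Type u} [LinearOrder A]

/-- `l + ω` is `ω`. -/
noncomputable def finSumNat (l : ℕ) : Fin l ⊕ₗ ℕ ≃o ℕ :=
  sumOrderIso (Fin.valOrderEmb l)
    (OrderEmbedding.ofStrictMono (fun n => n + l) fun a b h => by simpa using h)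
    (fun a b => lt_of_lt_of_le a.2 (Nat.le_add_left l b))
    (fun c => (lt_or_ge c l).imp (fun h => ⟨⟨c, h⟩, rfl⟩)
      fun h => ⟨c - l, Nat.sub_add_cancel h⟩)

theorem le_of_finSumNat_inr {l n : ℕ} : l ≤ finSumNat l (toLex (Sum.inr n)) :=
  Nat.le_add_left l n

/-- `ω* + l` is `ω*`. -/
noncomputable def natDualSumFin (l : ℕ) : ℕᵒᵈ ⊕ₗ Fin l ≃o ℕᵒᵈ :=
  sumOrderIso
    (OrderEmbedding.ofStrictMono (fun n => OrderDual.toDual (OrderDual.ofDual n + l))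
      fun a b h => by simpa using h)
    (OrderEmbedding.ofStrictMono (fun i => OrderDual.toDual (Fin.rev i : ℕ)) fun a b h =>
      OrderDual.toDual_lt_toDual.2 (Fin.lt_def.1 (Fin.rev_lt_rev.2 h)))
    (fun a b => OrderDual.toDual_lt_toDual.2
      (lt_of_lt_of_le (Fin.rev b).2 (Nat.le_add_left l _)))
    (fun c => (le_or_gt l (OrderDual.ofDual c)).imp
      (fun h => ⟨OrderDual.toDual (OrderDual.ofDual c - l), Nat.sub_add_cancel h⟩)
      fun h => ⟨Fin.rev ⟨OrderDual.ofDual c, h⟩,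
        congrArg (fun i : Fin l => OrderDual.toDual (i : ℕ)) (Fin.rev_rev _)⟩)

theorem le_of_natDualSumFin_inl {l : ℕ} {n : ℕᵒᵈ} :
    l ≤ OrderDual.ofDual (natDualSumFin l (toLex (Sum.inl n))) :=
  Nat.le_add_left l _

/-- `ω* + ω` is the ordering of the integers. -/
noncomputable def natDualSumNat : ℕᵒᵈ ⊕ₗ ℕ ≃o ℤ :=
  sumOrderIso
    (OrderEmbedding.ofStrictMono (fun n => -1 - ((OrderDual.ofDual n : ℕ) : ℤ)) fun a b h => by
      have : OrderDual.ofDual b < OrderDual.ofDual a := h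
      lia)
    (OrderEmbedding.ofStrictMono (fun n => (n : ℤ)) fun a b h => by simpa using h)
    (fun a b => show -1 - ((OrderDual.ofDual a : ℕ) : ℤ) < (b : ℤ) by lia)
    (fun c => (lt_or_ge c 0).imp (fun h => ⟨OrderDual.toDual (-1 - c).toNat,
      show -1 - (((-1 - c).toNat : ℕ) : ℤ) = c by lia⟩)
      fun h => ⟨c.toNat, Int.toNat_of_nonneg h⟩)

theorem hasInit_nat (l : ℕ) : HasInit ℕ l :=
  (HasInit.sum_left (hasInit_fin le_rfl)).of_iso (finSumNat l)

theorem hasInit_natDual_dual (l : ℕ) : HasInit ℕᵒᵈᵒᵈ l :=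
  (hasInit_nat l).of_iso (OrderIso.dualDual ℕ)

theorem le_two_natSumNatDual {C : Type u} [LinearOrder C] [Infinite C] : Le 2 (ℕ ⊕ₗ ℕᵒᵈ) C :=
  le_two_of_infinite (fun n => (hasInit_nat n).sum_left) fun n => ⟨ℕ ⊕ₗ ℕᵒᵈ, inferInstance,
    ⟨((OrderIso.refl ℕ).sumLexCongr (natDualSumFin n).symm).trans
      (OrderIso.sumLexAssoc _ _ _).symm⟩, fun m => (hasInit_nat m).sum_left⟩

/-- A challenge in `ω` lies in a finite initial segment, which is copied onto an initial run of `A`.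
What remains of `A` has no maximum, so `ω` is below it at level two. -/
theorem le_three_nat [Nonempty A] [NoMaxOrder A] (h : ∀ l, HasInit A l) : Le 3 A ℕ := by
  refine le_succ_iff.2 fun s hs => ?_
  obtain ⟨l, hl⟩ := hs.bddAbove
  obtain ⟨Z, _, ⟨e⟩⟩ := (h (l + 1)).exists_iso
  have := noMaxOrder_of_iso e
  have : Infinite (Fin (l + 1) ⊕ₗ Z) := Infinite.of_injective e e.injective
  have : Infinite Z := infinite_right (X := Fin (l + 1))
  have : NoMaxOrder Z := noMaxOrder_right (X := Fin (l + 1))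
  refine Cov.map e.symm (finSumNat (l + 1)) (Cov.sum (Cov.refl (toFinite _)) ?_)
  refine (le_two_of_noMaxOrder hasInit_nat).cov (eq_empty_of_forall_notMem fun n hn => ?_)
  have := hl hn
  have := le_of_finSumNat_inr (l := l + 1) (n := n)
  lia

theorem HasInit.exists_iso_dual {l : ℕ} (h : HasInit Aᵒᵈ l) :
    ∃ (Z : Type u) (_ : LinearOrder Z), Nonempty (A ≃o Z ⊕ₗ Fin l) := by
  obtain ⟨Z, _, ⟨e⟩⟩ := h.exists_iso
  exact ⟨Zᵒᵈ, inferInstance, ⟨(OrderIso.dualDual A).trans (e.dual.trans (dualFinSum l Z))⟩⟩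

theorem exists_bound_of_finite {s : Set (ℕ ⊕ₗ ℕᵒᵈ)} (hs : s.Finite) :
    ∃ l, (∀ n, toLex (Sum.inl n) ∈ s → n < l) ∧
      ∀ n : ℕᵒᵈ, toLex (Sum.inr n) ∈ s → OrderDual.ofDual n < l := by
  obtain ⟨l, hl⟩ := (hs.image
    (fun x => Sum.elim id OrderDual.ofDual (ofLex x) : ℕ ⊕ₗ ℕᵒᵈ → ℕ)).bddAbove
  exact ⟨l + 1, fun n hn => Nat.lt_succ_iff.2 (hl ⟨_, hn, rfl⟩),
    fun n hn => Nat.lt_succ_iff.2 (hl ⟨_, hn, rfl⟩)⟩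

theorem exists_bound_of_finite' {s : Set (ℕᵒᵈ ⊕ₗ ℕ)} (hs : s.Finite) :
    ∃ l, (∀ n, toLex (Sum.inr n) ∈ s → n < l) ∧
      ∀ n : ℕᵒᵈ, toLex (Sum.inl n) ∈ s → OrderDual.ofDual n < l := by
  obtain ⟨l, hl⟩ := (hs.image
    (fun x => Sum.elim OrderDual.ofDual id (ofLex x) : ℕᵒᵈ ⊕ₗ ℕ → ℕ)).bddAbove
  exact ⟨l + 1, fun n hn => Nat.lt_succ_iff.2 (hl ⟨_, hn, rfl⟩),
    fun n hn => Nat.lt_succ_iff.2 (hl ⟨_, hn, rfl⟩)⟩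

/-- `ω + ω*` is `l + (ω + ω*) + l`. -/
noncomputable def natSumNatDual (l : ℕ) :
    Fin l ⊕ₗ ((ℕ ⊕ₗ ℕᵒᵈ) ⊕ₗ Fin l) ≃o ℕ ⊕ₗ ℕᵒᵈ :=
  ((OrderIso.refl _).sumLexCongr (OrderIso.sumLexAssoc _ _ _)).trans
    ((OrderIso.sumLexAssoc _ _ _).symm.trans ((finSumNat l).sumLexCongr (natDualSumFin l)))

/-- A challenge lies in the first and last `l` elements. These are copied onto end runs of `A`, and
the remaining middle is infinite, hence above `ω + ω*` at level two. -/
theorem le_three_natSumNatDual [Infinite A] (h : ∀ l, HasInit A l) (h' : ∀ l, HasInit Aᵒᵈ l) :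
    Le 3 A (ℕ ⊕ₗ ℕᵒᵈ) := by
  refine le_succ_iff.2 fun s hs => ?_
  obtain ⟨l, h1, h2⟩ := exists_bound_of_finite hs
  obtain ⟨Z, _, ⟨e⟩⟩ := (h l).exists_iso
  have : Infinite (Fin l ⊕ₗ Z) := Infinite.of_injective e e.injective
  have : Infinite Z := infinite_right (X := Fin l)
  have : Infinite Zᵒᵈ := this
  obtain ⟨W, _, ⟨f⟩⟩ := (((h' l).of_iso (e.dual.trans (dualFinSum l Z))).of_sum).exists_iso_dual
  have : Infinite (W ⊕ₗ Fin l) := Infinite.of_injective f f.injective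
  have : Infinite W := infinite_left (Y := Fin l)
  refine Cov.map (e.trans ((OrderIso.refl _).sumLexCongr f)).symm (natSumNatDual l)
    (Cov.sum (Cov.refl (toFinite _)) (Cov.sum ?_ (Cov.refl (toFinite _))))
  refine le_two_natSumNatDual.cov (eq_empty_of_forall_notMem fun n hn => ?_)
  obtain ⟨n | n, rfl⟩ := toLex.surjective n
  · exact (h1 _ hn).not_ge le_of_finSumNat_inr
  · exact (h2 _ hn).not_ge le_of_natDualSumFin_inl

theorem exists_run_of_not_runsLe {N : ℕ} (h : ¬ RunsLe A N) :
    ∃ a b : A, a ≤ b ∧ (Icc a b).encard = (N + 1 : ℕ) := by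
  obtain ⟨a, b, h⟩ := nonempty_iff_ne_empty.2 h
  exact ⟨a, b, h⟩

theorem le_three_int [NoMinOrder A] [NoMaxOrder A] (h : ∀ N, ¬ RunsLe A N) : Le 3 A ℤ := by
  suffices Le 3 A (ℕᵒᵈ ⊕ₗ ℕ) from this.map (OrderIso.refl A) natDualSumNat
  refine le_succ_iff.2 fun s hs => ?_
  obtain ⟨l, h1, h2⟩ := exists_bound_of_finite' hs
  -- The failure of this bound gives a run of `2 * (l + 1)` elements, whose halves serve as the last
  -- `l + 1` elements of `ω*` and the first `l + 1` of `ω`.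
  obtain ⟨a, b, hab, hN⟩ := exists_run_of_not_runsLe (h ((l + 1) + l))
  obtain ⟨f⟩ := nonempty_orderIso_fin_of_encard hN
  have : Nonempty (Iio a) := ⟨⟨_, (exists_lt a).choose_spec⟩⟩
  have : Nonempty (Ioi b) := ⟨⟨_, (exists_gt b).choose_spec⟩⟩
  let e : (Iio a ⊕ₗ Fin (l + 1)) ⊕ₗ (Fin (l + 1) ⊕ₗ Ioi b) ≃o A :=
    (OrderIso.sumLexAssoc _ _ _).trans (((OrderIso.refl _).sumLexCongr
      ((OrderIso.sumLexAssoc _ _ _).symm.trans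
      (((sumFin (l + 1) (l + 1)).trans f.symm).sumLexCongr (OrderIso.refl _)))).trans (splitIcc hab))
  refine Cov.map e ((natDualSumFin (l + 1)).sumLexCongr (finSumNat (l + 1)))
    (Cov.sum (Cov.sum ?_ (Cov.refl (toFinite _))) (Cov.sum (Cov.refl (toFinite _)) ?_))
  · refine (le_two_of_noMinOrder hasInit_natDual_dual).cov
      (eq_empty_of_forall_notMem fun n hn => ?_)
    exact ((h2 _ hn).trans (Nat.lt_succ_self l)).not_ge le_of_natDualSumFin_inl
  · refine (le_two_of_noMaxOrder hasInit_nat).cov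
      (eq_empty_of_forall_notMem fun n hn => ?_)
    exact ((h1 _ hn).trans (Nat.lt_succ_self l)).not_ge le_of_finSumNat_inr

end Models

/-! ### Maximal runs and the gaps beside them -/

section Blocks

variable {A : Type u} [LinearOrder A]

theorem runsLe_dual {N : ℕ} (h : RunsLe A N) : RunsLe Aᵒᵈ N := by
  refine runsLe_of_encard_le fun a b hf => ?_
  have h1 : Icc a b = OrderDual.ofDual ⁻¹' Icc (OrderDual.ofDual b) (OrderDual.ofDual a) := by
    ext c
    exact and_comm
  have h2 : (OrderDual.ofDual ⁻¹' Icc (OrderDual.ofDual b) (OrderDual.ofDual a)).encard =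
      (Icc (OrderDual.ofDual b) (OrderDual.ofDual a)).encard :=
    encard_preimage_of_bijective OrderDual.ofDual.bijective _
  rw [h1] at hf ⊢
  rw [h2]
  refine h.encard_le ?_
  rw [← encard_lt_top_iff, ← h2, encard_lt_top_iff]
  exact hf

theorem le_of_runsLe_fin {n N : ℕ} (h : RunsLe (Fin n) N) : n ≤ N := by
  cases n with
  | zero => exact Nat.zero_le _
  | succ n =>
    have := h.encard_le (toFinite (Icc 0 (Fin.last n)))
    rw [show Icc (0 : Fin (n + 1)) (Fin.last n) = univ from
      eq_univ_of_forall fun i => ⟨Fin.zero_le _, Fin.le_last _⟩] at this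
    rw [encard_univ, ENat.card_eq_coe_fintype_card, Fintype.card_fin] at this
    exact_mod_cast this

theorem RunsLe.of_iso {B : Type v} [LinearOrder B] {N : ℕ} (h : RunsLe A N) (e : A ≃o B) :
    RunsLe B N :=
  RunsLe.of_le (Le.of_iso e) h

theorem HasInit.le_of_runsLe {l N : ℕ} (h : HasInit A l) (hN : RunsLe A N) : l ≤ N := by
  obtain ⟨Z, _, ⟨e⟩⟩ := h.exists_iso
  exact le_of_runsLe_fin ((hN.of_iso e).of_ordConnected (inlEmb _ _) ordConnected_range_inlEmb)

theorem InitIs.exists_natCast {c : ℕ∞} (h : InitIs A c) {N : ℕ} (hN : RunsLe A N) :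
    ∃ k : ℕ, c = k := by
  have : c ≤ N := ENat.forall_natCast_le_iff_le.1 fun l hl => by
    exact_mod_cast ((h l).2 hl).le_of_runsLe hN
  exact ⟨_, (ENat.natCast_toNat (ne_top_of_le_ne_top (ENat.natCast_ne_top N) this)).symm⟩

theorem InitIs.of_sum {X : Type v} {Y : Type w} [LinearOrder X] [LinearOrder Y] [Infinite X]
    {c : ℕ∞} (h : InitIs (X ⊕ₗ Y) c) : InitIs X c :=
  fun l => ⟨fun H => (h l).1 H.sum_left, fun H => ((h l).2 H).of_sum⟩

/-- Finite maximal runs at both ends can be split off. -/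
theorem exists_iso_of_initIs [Infinite A] {k k' : ℕ} (h : InitIs A k) (h' : InitIs Aᵒᵈ k') :
    ∃ (Z : Type u) (_ : LinearOrder Z), NoMinOrder Z ∧ NoMaxOrder Z ∧ Nonempty Z ∧
      Nonempty (A ≃o Fin k ⊕ₗ (Z ⊕ₗ Fin k')) := by
  obtain ⟨Z, _, hZ, ⟨e⟩⟩ := h.exists_iso
  have : Infinite (Fin k ⊕ₗ Z) := Infinite.of_injective e e.injective
  have : Infinite Z := infinite_right (X := Fin k)
  have : Infinite Zᵒᵈ := this
  obtain ⟨W, _, hW, ⟨f⟩⟩ := ((h'.of_iso (e.dual.trans (dualFinSum k Z))).of_sum).exists_iso_dual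
  have : Infinite (W ⊕ₗ Fin k') := Infinite.of_injective f f.injective
  have : Infinite W := infinite_left (Y := Fin k')
  have := noMinOrder_of_iso f
  exact ⟨W, inferInstance, noMinOrder_left (Y := Fin k'), hW, inferInstance,
    ⟨e.trans ((OrderIso.refl _).sumLexCongr f)⟩⟩

/-- A greatest element below `a` would extend the interval to the left by exactly one element. -/
theorem noMaxOrder_Iio {a b : A} (hab : a ≤ b)
    (h : ∀ c < a, (Icc c b).encard ≠ (Icc a b).encard + 1) : NoMaxOrder (Iio a) := by
  refine ⟨fun c => ?_⟩
  by_contra H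
  push Not at H
  refine h c c.2 ?_
  rw [← encard_insert_of_notMem (a := (c : A)) fun h => h.1.not_gt c.2]
  congr 1
  ext y
  constructor
  · intro hy
    rcases lt_or_ge y a with hya | hya
    · exact Or.inl (le_antisymm (H ⟨y, hya⟩) hy.1)
    · exact Or.inr ⟨hya, hy.2⟩
  · rintro (rfl | hy)
    · exact ⟨le_rfl, (le_of_lt c.2).trans hab⟩
    · exact ⟨(le_of_lt c.2).trans hy.1, hy.2⟩

theorem noMinOrder_Ioi {a b : A} (hab : a ≤ b)
    (h : ∀ c > b, (Icc a c).encard ≠ (Icc a b).encard + 1) : NoMinOrder (Ioi b) := by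
  refine ⟨fun c => ?_⟩
  by_contra H
  push Not at H
  refine h c c.2 ?_
  rw [← encard_insert_of_notMem (a := (c : A)) fun h => h.2.not_gt c.2]
  congr 1
  ext y
  constructor
  · intro hy
    rcases lt_or_ge b y with hya | hya
    · exact Or.inl (le_antisymm hy.2 (H ⟨y, hya⟩))
    · exact Or.inr ⟨hy.1, hya⟩
  · rintro (rfl | hy)
    · exact ⟨hab.trans (le_of_lt c.2), le_rfl⟩
    · exact ⟨hy.1, hy.2.trans (le_of_lt c.2)⟩

theorem RunsLe.noMaxOrder_Iio {N : ℕ} (h : RunsLe A N) {a b : A} (hab : a ≤ b)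
    (hN : (Icc a b).encard = N) : NoMaxOrder (Iio a) := by
  refine ThreeUniversal.noMaxOrder_Iio hab fun c _ hc => ?_
  rw [hN] at hc
  have := h.encard_le (a := c) (b := b) (finite_of_encard_eq_coe (k := N + 1) (by simpa using hc))
  rw [hc] at this
  exact absurd (show N + 1 ≤ N by exact_mod_cast this) (by simp)

theorem RunsLe.noMinOrder_Ioi {N : ℕ} (h : RunsLe A N) {a b : A} (hab : a ≤ b)
    (hN : (Icc a b).encard = N) : NoMinOrder (Ioi b) := by
  refine ThreeUniversal.noMinOrder_Ioi hab fun c _ hc => ?_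
  rw [hN] at hc
  have := h.encard_le (a := a) (b := c) (finite_of_encard_eq_coe (k := N + 1) (by simpa using hc))
  rw [hc] at this
  exact absurd (show N + 1 ≤ N by exact_mod_cast this) (by simp)

theorem runsLe_Iio {N : ℕ} (h : RunsLe A N) {a : A} : RunsLe (Iio a) N :=
  h.of_ordConnected (OrderEmbedding.subtype (· ∈ Set.Iio a)) (by
    rw [OrderEmbedding.coe_subtype, Subtype.range_coe]
    exact ordConnected_Iio)

theorem runsLe_Ioi {N : ℕ} (h : RunsLe A N) {a : A} : RunsLe (Ioi a) N :=
  h.of_ordConnected (OrderEmbedding.subtype (· ∈ Set.Ioi a)) (by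
    rw [OrderEmbedding.coe_subtype, Subtype.range_coe]
    exact ordConnected_Ioi)

/-- Runs of the maximal length `N` that start at different points are disjoint. -/
theorem RunsLe.lt_of_lt {N : ℕ} (hN : RunsLe A N) {a b c d : A} (hab : a ≤ b)
    (habN : (Icc a b).encard = N) (hcd : (Icc c d).encard = N) (hca : c < a) : d < a := by
  by_contra H
  rw [not_lt] at H
  have hf : (Icc c b).Finite :=
    ((finite_of_encard_eq_coe hcd).union (finite_of_encard_eq_coe habN)).subset fun y hy =>
      (le_total y d).imp (fun h => ⟨hy.1, h⟩) fun h => ⟨H.trans h, hy.2⟩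
  have h1 : insert c (Icc a b) ⊆ Icc c b :=
    insert_subset ⟨le_rfl, hca.le.trans hab⟩ (Icc_subset_Icc_left hca.le)
  have h2 := (encard_le_encard h1).trans (hN.encard_le hf)
  rw [encard_insert_of_notMem fun h => h.1.not_gt hca, habN] at h2
  exact absurd (show N + 1 ≤ N by exact_mod_cast h2) (by simp)

/-- By `RunsLe.lt_of_lt` the runs that start before the last chosen one end before it, so only one
of the `n + 1` is lost on passing to `Iio a`. -/
theorem RunsLe.le_encard_runStarts_Iio {N n : ℕ} (hN : RunsLe A N) {R : Set A}
    (hR : R ⊆ runStarts A N) (hRn : R.encard = (n + 1 : ℕ)) {a b : A} (ha : a ∈ R)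
    (hamax : ∀ ⦃c⦄, c ∈ R → a ≤ c → c ≤ a) (hab : a ≤ b) (habN : (Icc a b).encard = N) :
    (n : ℕ∞) ≤ (runStarts (Set.Iio a) N).encard := by
  have hsub : R \ {a} ⊆ Subtype.val '' runStarts (Set.Iio a) N := by
    rintro c ⟨hc, hca⟩
    have hca : c < a := not_le.1 fun h => hca (le_antisymm (hamax hc h) h)
    obtain ⟨d, hcd, hcdN⟩ := hR hc
    have hda := hN.lt_of_lt hab habN hcdN hca
    refine ⟨⟨c, hca⟩, ⟨⟨d, hda⟩, hcd, ?_⟩, rfl⟩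
    rw [← hcdN, ← encard_Icc_of_ordConnected (OrderEmbedding.subtype (· ∈ Set.Iio a)) (by
      rw [OrderEmbedding.coe_subtype, Subtype.range_coe]
      exact ordConnected_Iio)]
    rfl
  have h1 := encard_le_encard hsub
  rw [Subtype.val_injective.encard_image] at h1
  refine le_trans ?_ h1
  have h2 := encard_sdiff_singleton_add_one ha
  rw [hRn] at h2
  push_cast at h2
  exact (ENat.add_le_add_iff_right ENat.one_ne_top).1 h2.ge

/-- Every element lies in a maximal run. -/
theorem RunsLe.exists_block {N : ℕ} (h : RunsLe A N) (x : A) :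
    ∃ a b, a ≤ x ∧ x ≤ b ∧ ∃ j ≤ N, (Icc a b).encard = (j : ℕ) ∧ NoMaxOrder (Iio a) ∧
      NoMinOrder (Ioi b) := by
  classical
  let P : ℕ → Prop := fun k => ∃ a b, a ≤ x ∧ x ≤ b ∧ (Icc a b).encard = (k : ℕ)
  have bound : ∀ k, P k → k ≤ N := by
    rintro k ⟨a, b, -, -, hk⟩
    have := h.encard_le (finite_of_encard_eq_coe hk)
    rw [hk] at this
    exact_mod_cast this
  have h1 : P 1 := ⟨x, x, le_rfl, le_rfl, by simp⟩
  -- A longest finite interval around `x`. It exists because lengths are bounded by `N`, and no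
  -- element can be added to it at either end.
  obtain ⟨a, b, ha, hb, hk⟩ := Nat.findGreatest_spec (bound 1 h1) h1
  set k := Nat.findGreatest P N with hkdef
  have hmax : ¬ P (k + 1) := fun H =>
    Nat.findGreatest_is_greatest (Nat.lt_succ_self _) (bound _ H) H
  refine ⟨a, b, ha, hb, k, bound k ⟨a, b, ha, hb, hk⟩, hk, ?_, ?_⟩
  · refine ThreeUniversal.noMaxOrder_Iio (ha.trans hb) fun c hc hcb => hmax ?_
    exact ⟨c, b, hc.le.trans ha, hb, by rw [hcb, hk]; simp⟩
  · refine ThreeUniversal.noMinOrder_Ioi (ha.trans hb) fun c hc hcb => hmax ?_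
    exact ⟨a, c, ha, hb.trans hc.le, by rw [hcb, hk]; simp⟩

end Blocks

/-! ### Comparison with a dense sum of equal chains -/

section Dense

/-- The embedding of an ordered sum given by embeddings of the summands. -/
def sumOrderEmb {A : Type u} {B : Type v} {C : Type w} [LinearOrder A] [LinearOrder B]
    [LinearOrder C] (f : A ↪o C) (g : B ↪o C) (h : ∀ a b, f a < g b) : A ⊕ₗ B ↪o C :=
  OrderEmbedding.ofStrictMono (fun x => Sum.elim f g (ofLex x)) (by
    intro x y hxy
    obtain ⟨x | x, rfl⟩ := toLex.surjective x <;> obtain ⟨y | y, rfl⟩ := toLex.surjective y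
    · simpa using hxy
    · exact h x y
    · simp at hxy
    · simpa using hxy)

/-- Restriction of the index set of a lexicographic product. -/
def prodSubtypeEmb {E : Type u} (F : Type v) [LinearOrder E] [LinearOrder F] (s : Set E) :
    s ×ₗ F ↪o E ×ₗ F :=
  OrderEmbedding.ofStrictMono (fun p => toLex ((ofLex p).1.1, (ofLex p).2)) (by
    intro p q h
    rw [Prod.Lex.lt_iff] at h ⊢
    exact h.imp (fun h => h) (fun h => ⟨congrArg Subtype.val h.1, h.2⟩))

/-- A lexicographic product splits at the copy of `F` over `q`. -/
noncomputable def splitProd {E : Type u} (F : Type v) [LinearOrder E] [LinearOrder F] (q : E) :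
    (Iio q ×ₗ F) ⊕ₗ (F ⊕ₗ (Ioi q ×ₗ F)) ≃o E ×ₗ F :=
  sumOrderIso (prodSubtypeEmb F (Iio q))
    (sumOrderEmb (fiberEmb F q) (prodSubtypeEmb F (Ioi q))
      fun a b => Prod.Lex.lt_iff.2 (Or.inl (ofLex b).1.2))
    (by
      intro a b
      obtain ⟨b | b, rfl⟩ := toLex.surjective b
      · exact Prod.Lex.lt_iff.2 (Or.inl (ofLex a).1.2)
      · exact Prod.Lex.lt_iff.2 (Or.inl (lt_trans (b := q) (ofLex a).1.2 (ofLex b).1.2)))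
    (by
      intro c
      obtain ⟨⟨p, i⟩, rfl⟩ := toLex.surjective c
      rcases lt_trichotomy p q with h | rfl | h
      · exact Or.inl ⟨toLex (⟨p, h⟩, i), rfl⟩
      · exact Or.inr ⟨toLex (Sum.inl i), rfl⟩
      · exact Or.inr ⟨toLex (Sum.inr (toLex (⟨p, h⟩, i))), rfl⟩)

theorem ncard_preimage_lt {α : Type u} {β : Type v} {f : α → β} (hf : f.Injective) {s : Set β}
    (hs : s.Finite) {x : β} (hx : x ∈ s) (hxf : x ∉ range f) : (f ⁻¹' s).ncard < s.ncard := by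
  rw [← ncard_image_of_injective _ hf]
  refine ncard_lt_ncard ?_ hs
  refine ⟨image_preimage_subset f s, fun h => ?_⟩
  obtain ⟨y, -, hy⟩ := h hx
  exact hxf ⟨y, hy⟩

/-- The maximal run around the last challenged point has `j ≤ N` elements and is copied onto the
first `j` elements of the block over some `q`. The `i = N - j` leftover elements of the block join
the part above, where `C` is infinite and unchallenged, so level one is free. The index order `E` is
arbitrary rather than `ℚ` so that the induction can continue in `Iio q`. -/
theorem cov_one_prod {n N : ℕ} {E : Type v} [LinearOrder E] [DenselyOrdered E] [NoMinOrder E]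
    [NoMaxOrder E] [Nonempty E] {C : Type u} [LinearOrder C] [NoMinOrder C] [NoMaxOrder C]
    [Nonempty C] (hN : RunsLe C N) {s : Set C} (hs : s.Finite) (hn : s.ncard ≤ n) :
    Cov 1 (E ×ₗ Fin N) C s := by
  induction n generalizing E C with
  | zero =>
    have : s = ∅ := by rwa [Nat.le_zero, ncard_eq_zero hs] at hn
    have := NoMaxOrder.infinite (α := C)
    exact le_one_of_infinite.cov ‹s = ∅›
  | succ n ih =>
    rcases s.eq_empty_or_nonempty with rfl | hne
    · have := NoMaxOrder.infinite (α := C)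
      exact le_one_of_infinite.cov rfl
    obtain ⟨x, hx, hmax⟩ := hs.exists_maximal hne
    obtain ⟨a, b, hax, hxb, j, hj, hab, hmaxa, hminb⟩ := hN.exists_block x
    obtain ⟨i, rfl⟩ := Nat.exists_eq_add_of_le hj
    obtain ⟨f⟩ := nonempty_orderIso_fin_of_encard hab
    obtain ⟨q⟩ := (inferInstance : Nonempty E)
    obtain ⟨a', ha'⟩ := exists_lt a
    obtain ⟨q', hq'⟩ := exists_lt q
    obtain ⟨b', hb'⟩ := exists_gt b
    have : Nonempty (Iio a) := ⟨⟨a', ha'⟩⟩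
    have : Nonempty (Iio q) := ⟨⟨q', hq'⟩⟩
    have : Nonempty (Ioi b) := ⟨⟨b', hb'⟩⟩
    have := NoMinOrder.infinite (α := Ioi b)
    refine Cov.map (((OrderIso.refl _).sumLexCongr ((OrderIso.sumLexAssoc _ _ _).symm.trans
      ((sumFin j i).sumLexCongr (OrderIso.refl _)))).trans (splitProd (Fin (j + i)) q))
      (splitIcc (hax.trans hxb)) (Cov.sum ?_ (Cov.sum ?_ ?_))
    · have hlt : ((Subtype.val : Iio a → C) ⁻¹' s).ncard < s.ncard :=
        ncard_preimage_lt Subtype.val_injective hs hx (by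
          rw [Subtype.range_coe]
          exact hax.not_gt)
      exact ih (s := (Subtype.val : Iio a → C) ⁻¹' s) (runsLe_Iio hN)
        (hs.preimage Subtype.val_injective.injOn) (Nat.lt_succ_iff.1 (hlt.trans_le hn))
    · exact (Cov.refl (toFinite _)).map (OrderIso.refl _) f.symm
    · refine le_one_of_infinite.cov (eq_empty_of_forall_notMem fun y hy => ?_)
      have h1 : x < y := lt_of_le_of_lt hxb y.2
      exact h1.not_ge (hmax (show (y : C) ∈ s from hy) h1.le)

/-- A dense sum of copies of the `N`-element chain is, at level two, below every ordering without
endpoints in which no `N + 1` elements are successive. -/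
theorem le_two_prod {N : ℕ} {E : Type v} [LinearOrder E] [DenselyOrdered E] [NoMinOrder E]
    [NoMaxOrder E] [Nonempty E] {C : Type u} [LinearOrder C] [NoMinOrder C] [NoMaxOrder C]
    [Nonempty C] (hN : RunsLe C N) : Le 2 (E ×ₗ Fin N) C :=
  le_succ_iff.2 fun _ hs => cov_one_prod hN hs le_rfl

/-- Whole blocks must be copied onto runs of length exactly `N`. The last challenged block goes to
the last of `n + 1` chosen runs, and the earlier runs remain available below it. The unchallenged
part above is handled by `le_two_prod`. -/
theorem cov_two_prod {n N : ℕ} {E : Type v} [LinearOrder E] [DenselyOrdered E] [NoMinOrder E]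
    [NoMaxOrder E] [Nonempty E] {A : Type u} [LinearOrder A] [NoMinOrder A] [NoMaxOrder A]
    [Nonempty A] (hN : RunsLe A N) (hruns : (n : ℕ∞) ≤ (runStarts A N).encard)
    {T : Set E} (hT : T.Finite) (hn : T.ncard ≤ n) {s : Set (E ×ₗ Fin N)}
    (hs : ∀ p ∈ s, (ofLex p).1 ∈ T) : Cov 2 A (E ×ₗ Fin N) s := by
  induction n generalizing E A with
  | zero =>
    have : T = ∅ := by rwa [Nat.le_zero, ncard_eq_zero hT] at hn
    refine (le_two_prod hN).cov (eq_empty_of_forall_notMem fun p hp => ?_)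
    simpa [this] using hs p hp
  | succ n ih =>
    rcases T.eq_empty_or_nonempty with rfl | hne
    · exact (le_two_prod hN).cov (eq_empty_of_forall_notMem fun p hp => by simpa using hs p hp)
    obtain ⟨q, hq, hmax⟩ := hT.exists_maximal hne
    obtain ⟨R, hR, hRn⟩ := exists_subset_encard_eq hruns
    have hRf : R.Finite := finite_of_encard_eq_coe hRn
    obtain ⟨a, ha, hamax⟩ := hRf.exists_maximal (nonempty_of_encard_ne_zero (by rw [hRn]; simp))
    obtain ⟨b, hab, habN⟩ := hR ha
    obtain ⟨f⟩ := nonempty_orderIso_fin_of_encard habN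
    obtain ⟨a', ha'⟩ := exists_lt a
    obtain ⟨q', hq'⟩ := exists_lt q
    obtain ⟨r', hr'⟩ := exists_gt q
    obtain ⟨b', hb'⟩ := exists_gt b
    have : Nonempty (Iio a) := ⟨⟨a', ha'⟩⟩
    have : Nonempty (Iio q) := ⟨⟨q', hq'⟩⟩
    have : Nonempty (Ioi q) := ⟨⟨r', hr'⟩⟩
    have : Nonempty (Ioi b) := ⟨⟨b', hb'⟩⟩
    have := hN.noMaxOrder_Iio hab habN
    have := hN.noMinOrder_Ioi hab habN
    have hrunsa : (n : ℕ∞) ≤ (runStarts (Iio a) N).encard :=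
      hN.le_encard_runStarts_Iio hR hRn ha hamax hab habN
    refine Cov.map (((OrderIso.refl _).sumLexCongr (f.symm.sumLexCongr (OrderIso.refl _))).trans
      (splitIcc hab)) (splitProd (Fin N) q) (Cov.sum ?_ (Cov.sum (Cov.refl (toFinite _)) ?_))
    · refine ih (T := Subtype.val ⁻¹' T) (runsLe_Iio hN) hrunsa (hT.preimage Subtype.val_injective.injOn)
        (Nat.lt_succ_iff.1 (lt_of_lt_of_le
          (ncard_preimage_lt Subtype.val_injective hT hq ?_) hn)) ?_
      · rw [Subtype.range_coe]
        exact lt_irrefl q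
      · intro p hp
        exact hs _ hp
    · refine (le_two_prod (runsLe_Ioi hN)).cov (eq_empty_of_forall_notMem fun y hy => ?_)
      have h1 := hs _ hy
      have h2 : q < (ofLex y).1 := (ofLex y).1.2
      exact h2.not_ge (hmax h1 h2.le)

theorem le_three_prod {N : ℕ} {E : Type v} [LinearOrder E] [DenselyOrdered E] [NoMinOrder E]
    [NoMaxOrder E] [Nonempty E] {A : Type u} [LinearOrder A] [NoMinOrder A] [NoMaxOrder A]
    [Nonempty A] (hN : RunsLe A N) (hruns : (runStarts A N).Infinite) :
    Le 3 A (E ×ₗ Fin N) :=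
  le_succ_iff.2 fun s hs => cov_two_prod hN (by rw [hruns.encard_eq]; exact le_top)
    (hs.image fun p => (ofLex p).1) le_rfl fun _ hp => mem_image_of_mem _ hp

end Dense

/-! ### Finite sums coded as words -/

section Words

/-- The ordering `n + m₀ · ℚ + n₁ + m₁ · ℚ + ⋯` for the list `(m₀, n₁), (m₁, n₂), …`. -/
noncomputable def wordOrd : ℕ → List (ℕ × ℕ) → LinOrd.{0}
  | n, [] => LinOrd.of (Fin n)
  | n, q :: t => LinOrd.of (Fin n ⊕ₗ ((ℚ ×ₗ Fin q.1) ⊕ₗ wordOrd q.2 t))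

/-- With `wordCons`, this names the unfolding of `wordOrd`, so that isomorphisms of summands can be
composed explicitly. -/
noncomputable def wordNil (n : ℕ) : wordOrd n [] ≃o Fin n := OrderIso.refl _

noncomputable def wordCons (n : ℕ) (q : ℕ × ℕ) (t : List (ℕ × ℕ)) :
    wordOrd n (q :: t) ≃o Fin n ⊕ₗ ((ℚ ×ₗ Fin q.1) ⊕ₗ wordOrd q.2 t) :=
  OrderIso.refl _

/-- Inner chains are longer than the adjacent multiplicities. -/
def GoodWord (t : List (ℕ × ℕ)) : Prop :=
  t.IsChain fun p q => p.1 < p.2 ∧ q.1 < p.2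

theorem goodWord_cons_cons {p q : ℕ × ℕ} {t : List (ℕ × ℕ)} :
    GoodWord (p :: q :: t) ↔ (p.1 < p.2 ∧ q.1 < p.2) ∧ GoodWord (q :: t) :=
  List.isChain_cons_cons

theorem goodWord_nil : GoodWord [] := List.isChain_nil

theorem goodWord_singleton (q : ℕ × ℕ) : GoodWord [q] := List.isChain_singleton q

theorem GoodWord.tail {q : ℕ × ℕ} {t : List (ℕ × ℕ)} (h : GoodWord (q :: t)) : GoodWord t :=
  List.IsChain.tail h

/-- The length of the last chain of a word. -/
def lastLen : ℕ → List (ℕ × ℕ) → ℕ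
  | n, [] => n
  | _, q :: t => lastLen q.2 t

theorem hasInit_wordOrd (n : ℕ) (t : List (ℕ × ℕ)) : HasInit (wordOrd n t) n := by
  cases t with
  | nil => exact (hasInit_fin le_rfl).of_iso (wordNil n).symm
  | cons q t => exact (hasInit_fin le_rfl).sum_left.of_iso (wordCons n q t).symm

theorem hasInit_wordOrd_dual (n : ℕ) (t : List (ℕ × ℕ)) :
    HasInit (wordOrd n t)ᵒᵈ (lastLen n t) := by
  induction t generalizing n with
  | nil => exact (hasInit_fin le_rfl).of_iso (Fin.revOrderIso.symm.trans (wordNil n).symm.dual)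
  | cons q t ih =>
    have h1 := ((ih q.2).sum_left (Y := (ℚ ×ₗ Fin q.1)ᵒᵈ)).of_iso
      (OrderIso.sumLexDualAntidistrib _ _).symm
    have h2 := (h1.sum_left (Y := (Fin n)ᵒᵈ)).of_iso (OrderIso.sumLexDualAntidistrib _ _).symm
    exact h2.of_iso (wordCons n q t).symm.dual

theorem nonempty_finSumWord (n p : ℕ) (t : List (ℕ × ℕ)) :
    Nonempty (Fin n ⊕ₗ wordOrd p t ≃o wordOrd (n + p) t) := by
  cases t with
  | nil => exact ⟨((OrderIso.refl _).sumLexCongr (wordNil p)).trans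
      ((sumFin n p).trans (wordNil _).symm)⟩
  | cons q t => exact ⟨((OrderIso.refl _).sumLexCongr (wordCons p q t)).trans
      ((OrderIso.sumLexAssoc _ _ _).symm.trans (((sumFin n p).sumLexCongr (OrderIso.refl _)).trans
      (wordCons _ q t).symm))⟩

/-- The empty last chain of the left word, the chain `N` and the empty first chain of the right word
merge into one inner chain, which exceeds every multiplicity. The clause about a preceding letter
`(m, n)` carries the induction on the left word. -/
theorem exists_concat {N : ℕ} {t' : List (ℕ × ℕ)} (ht' : GoodWord t')
    (hN' : ∀ q ∈ t', q.1 < N) (n : ℕ) (t : List (ℕ × ℕ)) (ht : GoodWord t)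
    (hN : ∀ q ∈ t, q.1 < N) (hlast : lastLen n t = 0) :
    ∃ p s, GoodWord s ∧ (∀ q ∈ s, q.1 < N) ∧
      (∀ m < N, GoodWord ((m, n) :: t) → GoodWord ((m, p) :: s)) ∧
      Nonempty (wordOrd n t ⊕ₗ (Fin N ⊕ₗ wordOrd 0 t') ≃o wordOrd p s) := by
  induction t generalizing n with
  | nil =>
    obtain rfl : n = 0 := hlast
    obtain ⟨e⟩ := nonempty_finSumWord N 0 t'
    refine ⟨N, t', ht', hN', fun m hm _ => ?_,
      ⟨((wordNil 0).sumLexCongr e).trans OrderIso.emptySumLex⟩⟩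
    cases t' with
    | nil => exact goodWord_singleton _
    | cons q t' => exact goodWord_cons_cons.2 ⟨⟨hm, hN' q (by simp)⟩, ht'⟩
  | cons q t ih =>
    obtain ⟨p, s, h1, h2, h3, ⟨e⟩⟩ := ih q.2 ht.tail (fun r hr => hN r (by simp [hr])) hlast
    have hq := h3 q.1 (hN q (by simp)) ht
    refine ⟨n, (q.1, p) :: s, hq, ?_, fun m _ hm => ?_, ?_⟩
    · intro r hr
      rcases List.mem_cons.1 hr with rfl | hr
      · exact hN q (by simp)
      · exact h2 r hr
    · exact goodWord_cons_cons.2 ⟨(goodWord_cons_cons.1 hm).1, hq⟩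
    · exact ⟨((wordCons n q t).sumLexCongr (OrderIso.refl _)).trans
        ((OrderIso.sumLexAssoc _ _ _).trans (((OrderIso.refl _).sumLexCongr
        ((OrderIso.sumLexAssoc _ _ _).trans ((OrderIso.refl _).sumLexCongr e))).trans
        (wordCons n (q.1, p) s).symm))⟩

end Words

/-! ### Every ordering lies below a model -/

section Universality

variable {A : Type u} [LinearOrder A]

theorem isEmpty_of_runsLe_zero (h : RunsLe A 0) : IsEmpty A := by
  refine ⟨fun a => ?_⟩
  have := h.encard_le (toFinite (Icc a a))
  simp at this

theorem exists_word_of_infinite {N : ℕ} (h : RunsLe A (N + 1))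
    (hinf : (runStarts A (N + 1)).Infinite) :
    ∃ k k' : ℕ, Le 3 A (wordOrd k [(N + 1, k')]) := by
  have : Infinite A := infinite_univ_iff.1 (hinf.mono (subset_univ _))
  obtain ⟨c, hc⟩ := exists_initIs A
  obtain ⟨d, hd⟩ := exists_initIs Aᵒᵈ
  obtain ⟨k, rfl⟩ := hc.exists_natCast h
  obtain ⟨k', rfl⟩ := hd.exists_natCast (runsLe_dual h)
  obtain ⟨Z, _, _, _, _, ⟨e⟩⟩ := exists_iso_of_initIs hc hd
  have := NoMinOrder.infinite (α := Z)
  have hmin : NoMinOrder (Z ⊕ₗ Fin k') := inferInstance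
  have h1 : RunsLe (Z ⊕ₗ Fin k') (N + 1) :=
    (h.of_iso e).of_ordConnected (inrEmb _ _) ordConnected_range_inrEmb
  have h2 : RunsLe Z (N + 1) := h1.of_ordConnected (inlEmb _ _) ordConnected_range_inlEmb
  have h3 : (runStarts Z (N + 1)).Infinite := by
    -- The two finite ends contribute only finitely many runs, so the infinitely many runs of `A`
    -- lie in `Z`.
    intro hf
    have := encard_runStarts_le (Le.of_iso e.symm) (N + 1)
    rw [runStarts_sum (Or.inr hmin), runStarts_sum (Or.inl ‹_›)] at this
    refine hinf ?_
    rw [← encard_lt_top_iff]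
    refine this.trans_lt ?_
    rw [encard_lt_top_iff]
    exact ((toFinite _).image _).union (((hf.image _).union ((toFinite _).image _)).image _)
  refine ⟨k, k', Le.map e.symm (wordCons k (N + 1, k') []).symm
    ((Le.refl 3 _).sum ((le_three_prod h2 h3).sum (Le.of_iso (wordNil k').symm)))⟩

theorem runStarts_Iio_ncard_lt {N : ℕ} (hf : (runStarts A N).Finite) {a : A}
    (ha : a ∈ runStarts A N) :
    (runStarts (Iio a) N).Finite ∧ (runStarts (Iio a) N).ncard < (runStarts A N).ncard := by
  have hsub : Subtype.val '' runStarts (Iio a) N ⊆ runStarts A N :=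
    image_runStarts_subset (OrderEmbedding.subtype (· ∈ Iio a)) (by
      rw [OrderEmbedding.coe_subtype, Subtype.range_coe]
      exact ordConnected_Iio) N
  refine ⟨(hf.subset hsub).of_finite_image Subtype.val_injective.injOn, ?_⟩
  rw [← ncard_image_of_injective _ Subtype.val_injective]
  refine ncard_lt_ncard ⟨hsub, fun h => ?_⟩ hf
  obtain ⟨x, -, hx⟩ := h ha
  exact x.2.ne hx

theorem runStarts_Ioi_ncard_lt {N : ℕ} (hf : (runStarts A N).Finite) {a b : A} (hab : a ≤ b)
    (ha : a ∈ runStarts A N) :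
    (runStarts (Ioi b) N).Finite ∧ (runStarts (Ioi b) N).ncard < (runStarts A N).ncard := by
  have hsub : Subtype.val '' runStarts (Ioi b) N ⊆ runStarts A N :=
    image_runStarts_subset (OrderEmbedding.subtype (· ∈ Ioi b)) (by
      rw [OrderEmbedding.coe_subtype, Subtype.range_coe]
      exact ordConnected_Ioi) N
  refine ⟨(hf.subset hsub).of_finite_image Subtype.val_injective.injOn, ?_⟩
  rw [← ncard_image_of_injective _ Subtype.val_injective]
  refine ncard_lt_ncard ⟨hsub, fun h => ?_⟩ hf
  obtain ⟨x, -, hx⟩ := h ha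
  exact (hab.trans_lt x.2).ne' hx

/-- Cutting out a run of the maximal length `N + 1` leaves sides with fewer such runs. Neither side
has an endpoint at the cut, so their words have empty chains there, as `exists_concat` requires.
When no such run is left, the bound drops to `N`. -/
theorem exists_word_of_finite {N : ℕ}
    (ih : ∀ (A : Type u) [LinearOrder A], RunsLe A N →
      ∃ n t, GoodWord t ∧ (∀ q ∈ t, q.1 ≤ N) ∧ Le 3 A (wordOrd n t))
    (r : ℕ) (A : Type u) [LinearOrder A] (h : RunsLe A (N + 1))
    (hf : (runStarts A (N + 1)).Finite) (hr : (runStarts A (N + 1)).ncard ≤ r) :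
    ∃ n t, GoodWord t ∧ (∀ q ∈ t, q.1 < N + 1) ∧ Le 3 A (wordOrd n t) := by
  induction r generalizing A with
  | zero =>
    rw [Nat.le_zero, ncard_eq_zero hf] at hr
    obtain ⟨n, t, h1, h2, h3⟩ := ih A hr
    exact ⟨n, t, h1, fun q hq => Nat.lt_succ_iff.2 (h2 q hq), h3⟩
  | succ r ihr =>
    rcases (runStarts A (N + 1)).eq_empty_or_nonempty with h0 | ⟨a, ha⟩
    · obtain ⟨n, t, h1, h2, h3⟩ := ih A h0
      exact ⟨n, t, h1, fun q hq => Nat.lt_succ_iff.2 (h2 q hq), h3⟩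
    have ha' := ha
    obtain ⟨b, hab, habN⟩ := ha'
    obtain ⟨f⟩ := nonempty_orderIso_fin_of_encard habN
    have hIio := runStarts_Iio_ncard_lt hf ha
    have hIoi := runStarts_Ioi_ncard_lt hf hab ha
    obtain ⟨n, t, h1, h2, h3⟩ := ihr (Iio a) (runsLe_Iio h) hIio.1 (by lia)
    obtain ⟨n', t', h1', h2', h3'⟩ := ihr (Ioi b) (runsLe_Ioi h) hIoi.1 (by lia)
    have := h.noMaxOrder_Iio hab habN
    have := h.noMinOrder_Ioi hab habN
    have hlast : lastLen n t = 0 :=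
      ((hasInit_wordOrd_dual n t).of_le h3.of_succ.dual).eq_zero
    obtain rfl : n' = 0 := ((hasInit_wordOrd n' t').of_le h3'.of_succ).eq_zero
    obtain ⟨p, s, g1, g2, -, ⟨e⟩⟩ := exists_concat h1' h2' n t h1 h2 hlast
    exact ⟨p, s, g1, g2, (h3.sum ((Le.of_iso f).sum h3')).map (splitIcc hab) e⟩

theorem exists_word_of_runsLe (N : ℕ) (A : Type u) [LinearOrder A] (h : RunsLe A N) :
    ∃ n t, GoodWord t ∧ (∀ q ∈ t, q.1 ≤ N) ∧ Le 3 A (wordOrd n t) := by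
  induction N generalizing A with
  | zero =>
    have := isEmpty_of_runsLe_zero h
    exact ⟨0, [], goodWord_nil, by simp,
      Le.of_iso (OrderIso.trans ⟨Equiv.equivOfIsEmpty A (Fin 0), fun {a} => isEmptyElim a⟩
        (wordNil 0).symm)⟩
  | succ N ih =>
    by_cases hf : (runStarts A (N + 1)).Finite
    · obtain ⟨n, t, h1, h2, h3⟩ := exists_word_of_finite ih _ A h hf le_rfl
      exact ⟨n, t, h1, fun q hq => (h2 q hq).le, h3⟩
    · obtain ⟨k, k', h3⟩ := exists_word_of_infinite h hf
      exact ⟨k, _, goodWord_singleton _, by simp, h3⟩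

/-- The orderings `ω + ω*`, `ω + k`, `k + ω*` and `k + ℤ + k'`, with the sizes of the maximal runs
at both ends. -/
def UnboundedModel (c d : ℕ∞) (B : Type u) [LinearOrder B] : Prop :=
  (c = ⊤ ∧ d = ⊤ ∧ Nonempty (B ≃o ℕ ⊕ₗ ℕᵒᵈ)) ∨
    (∃ k : ℕ, c = ⊤ ∧ d = k ∧ Nonempty (B ≃o ℕ ⊕ₗ Fin k)) ∨
    (∃ k : ℕ, c = k ∧ d = ⊤ ∧ Nonempty (B ≃o Fin k ⊕ₗ ℕᵒᵈ)) ∨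
    ∃ k k' : ℕ, c = k ∧ d = k' ∧ Nonempty (B ≃o (Fin k ⊕ₗ ℤ) ⊕ₗ Fin k')

theorem exists_unboundedModel [Infinite A] (h : ∀ N, ¬ RunsLe A N) :
    ∃ (B : Type) (_ : LinearOrder B) (c d : ℕ∞), UnboundedModel c d B ∧ Le 3 A B := by
  obtain ⟨c, hc⟩ := exists_initIs A
  obtain ⟨d, hd⟩ := exists_initIs Aᵒᵈ
  induction c using ENat.recTopCoe with
  | top =>
    induction d using ENat.recTopCoe with
    | top =>
      exact ⟨_, _, ⊤, ⊤, Or.inl ⟨rfl, rfl, ⟨OrderIso.refl _⟩⟩,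
        le_three_natSumNatDual (fun l => (hc l).2 le_top) fun l => (hd l).2 le_top⟩
    | coe k =>
      obtain ⟨Z, _, _, ⟨e⟩⟩ := hd.exists_iso_dual
      have : Infinite (Z ⊕ₗ Fin k) := Infinite.of_injective e e.injective
      have : Infinite Z := infinite_left (Y := Fin k)
      refine ⟨_, _, ⊤, k, Or.inr (Or.inl ⟨k, rfl, rfl, ⟨OrderIso.refl _⟩⟩),
        ((le_three_nat fun l => ?_).sum (Le.refl 3 _)).map e.symm (OrderIso.refl _)⟩
      exact (((hc l).2 le_top).of_iso e).of_sum
  | coe k =>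
    induction d using ENat.recTopCoe with
    | top =>
      obtain ⟨Z, _, _, ⟨e⟩⟩ := hc.exists_iso
      have : Infinite (Fin k ⊕ₗ Z) := Infinite.of_injective e e.injective
      have : Infinite Z := infinite_right (X := Fin k)
      have : Infinite Zᵒᵈ := this
      have h1 : Le 3 Zᵒᵈ ℕ := le_three_nat fun l =>
        (((hd l).2 le_top).of_iso (e.dual.trans (dualFinSum k Z))).of_sum
      exact ⟨_, _, k, ⊤, Or.inr (Or.inr (Or.inl ⟨k, rfl, rfl, ⟨OrderIso.refl _⟩⟩)),
        ((Le.refl 3 _).sum (h1.dual.map (OrderIso.dualDual Z).symm (OrderIso.refl _))).map e.symm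
          (OrderIso.refl _)⟩
    | coe k' =>
      obtain ⟨Z, _, _, _, _, ⟨e⟩⟩ := exists_iso_of_initIs hc hd
      -- Removing finite ends keeps runs unbounded: a bound for `Z` and the sizes of the ends would
      -- bound the runs of `A`.
      have h1 : ∀ N, ¬ RunsLe Z N := fun N hN => by
        refine h (max N (max k k')) (RunsLe.of_iso ?_ e.symm)
        exact (runsLe_fin (by simp)).sum ((hN.mono (by simp)).sum (runsLe_fin (by simp))
          (Or.inl ‹_›)) (Or.inr inferInstance)
      exact ⟨_, _, k, k', Or.inr (Or.inr (Or.inr ⟨k, k', rfl, rfl, ⟨OrderIso.refl _⟩⟩)),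
        ((Le.refl 3 _).sum ((le_three_int h1).sum (Le.refl 3 _))).map e.symm
          (OrderIso.sumLexAssoc _ _ _).symm⟩

end Universality

/-! ### Translating between indexed sums and words -/

section FiniteSums

/-- The first summand of a finite lexicographic sum can be split off. -/
noncomputable def sigmaFinSucc (k : ℕ) (F : Fin (k + 1) → Type) [∀ i, LinearOrder (F i)] :
    F 0 ⊕ₗ (Σₗ i : Fin k, F i.succ) ≃o Σₗ i, F i :=
  sumOrderIso
    (OrderEmbedding.ofStrictMono (fun x => (toLex ⟨0, x⟩ : Σₗ i, F i))
      fun x y h => Sigma.Lex.right _ _ h)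
    (OrderEmbedding.ofStrictMono
      (fun p : Σₗ i : Fin k, F i.succ => (toLex ⟨(ofLex p).1.succ, (ofLex p).2⟩ : Σₗ i, F i))
      (by
        rintro _ _ (⟨x, y, h⟩ | ⟨x, y, h⟩)
        · exact Sigma.Lex.left _ _ (Fin.succ_lt_succ_iff.2 h)
        · exact Sigma.Lex.right _ _ h))
    (fun x p => Sigma.Lex.left _ _ (Fin.succ_pos _))
    (by
      intro c
      obtain ⟨⟨i, x⟩, rfl⟩ := toLex.surjective c
      induction i using Fin.cases with
      | zero => exact Or.inl ⟨x, rfl⟩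
      | succ i => exact Or.inr ⟨toLex ⟨i, x⟩, rfl⟩)

noncomputable def finiteSumZero (n m : ℕ → ℕ) : FiniteSum 0 n m ≃o Fin (n 0) :=
  have : IsEmpty (Σₗ i : Fin 0, (Fin (n i) ⊕ₗ (ℚ ×ₗ Fin (m i)))) := ⟨fun p => (ofLex p).1.elim0⟩
  OrderIso.emptySumLex

noncomputable def finiteSumSucc (k : ℕ) (n m : ℕ → ℕ) :
    FiniteSum (k + 1) n m ≃o
      Fin (n 0) ⊕ₗ ((ℚ ×ₗ Fin (m 0)) ⊕ₗ FiniteSum k (fun i => n (i + 1)) fun i => m (i + 1)) :=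
  ((sigmaFinSucc k fun i => Fin (n i) ⊕ₗ (ℚ ×ₗ Fin (m i))).symm.sumLexCongr
    (OrderIso.refl (Fin (n (k + 1))))).trans
    ((OrderIso.sumLexAssoc _ _ _).trans (OrderIso.sumLexAssoc _ _ _))

/-- The list of the pairs `(m_i, n_{i+1})`. -/
def toList : ℕ → (ℕ → ℕ) → (ℕ → ℕ) → List (ℕ × ℕ)
  | 0, _, _ => []
  | k + 1, n, m => (m 0, n 1) :: toList k (fun i => n (i + 1)) fun i => m (i + 1)

theorem nonempty_finiteSum_iso (k : ℕ) (n m : ℕ → ℕ) :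
    Nonempty (FiniteSum k n m ≃o wordOrd (n 0) (toList k n m)) := by
  induction k generalizing n m with
  | zero => exact ⟨(finiteSumZero n m).trans (wordNil _).symm⟩
  | succ k ih =>
    obtain ⟨e⟩ := ih (fun i => n (i + 1)) fun i => m (i + 1)
    exact ⟨(finiteSumSucc k n m).trans (((OrderIso.refl _).sumLexCongr
      ((OrderIso.refl _).sumLexCongr e)).trans (wordCons (n 0) (m 0, n 1) _).symm)⟩

theorem innerDominates_succ {k : ℕ} {n m : ℕ → ℕ} :
    InnerDominates (k + 1) n m ↔ (0 < k → m 0 < n 1 ∧ m 1 < n 1) ∧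
      InnerDominates k (fun i => n (i + 1)) fun i => m (i + 1) := by
  constructor
  · exact fun h => ⟨fun hk => h 0 (by lia), fun i hi => h (i + 1) (by lia)⟩
  · rintro ⟨h0, h1⟩ i hi
    cases i with
    | zero => exact h0 (by lia)
    | succ i => exact h1 i (by lia)

theorem goodWord_toList {k : ℕ} {n m : ℕ → ℕ} :
    GoodWord (toList k n m) ↔ InnerDominates k n m := by
  induction k generalizing n m with
  | zero => exact ⟨fun _ i hi => absurd hi (by lia), fun _ => goodWord_nil⟩
  | succ k ih =>
    rw [innerDominates_succ, ← ih]
    cases k with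
    | zero => simp [toList, goodWord_singleton, goodWord_nil]
    | succ k => simp [toList, goodWord_cons_cons]

theorem exists_toList_eq (n : ℕ) (t : List (ℕ × ℕ)) : ∃ k f g, f 0 = n ∧ toList k f g = t := by
  induction t generalizing n with
  | nil => exact ⟨0, fun _ => n, fun _ => 0, rfl, rfl⟩
  | cons q t ih =>
    obtain ⟨k, f, g, h1, h2⟩ := ih q.2
    exact ⟨k + 1, fun i => Nat.casesOn i n f, fun i => Nat.casesOn i q.1 g, rfl, by
      simp [toList, h1, h2]⟩

/-- All multiplicities can be made positive. -/
theorem exists_positive (n : ℕ) (t : List (ℕ × ℕ)) (ht : GoodWord t) :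
    ∃ p s, GoodWord s ∧ (∀ q ∈ s, 0 < q.1) ∧
      (∀ m, GoodWord ((m, n) :: t) → GoodWord ((m, p) :: s)) ∧
      Nonempty (wordOrd n t ≃o wordOrd p s) := by
  induction t generalizing n with
  | nil => exact ⟨n, [], goodWord_nil, by simp, fun m _ => goodWord_singleton _, ⟨OrderIso.refl _⟩⟩
  | cons q t ih =>
    obtain ⟨m, n₁⟩ := q
    obtain ⟨p, s, h1, h2, h3, ⟨e⟩⟩ := ih n₁ ht.tail
    have h4 := h3 m ht
    rcases Nat.eq_zero_or_pos m with rfl | hm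
    · obtain ⟨f⟩ := nonempty_finSumWord n p s
      have : IsEmpty (ℚ ×ₗ Fin 0) := ⟨fun x => (ofLex x).2.elim0⟩
      refine ⟨n + p, s, h1, h2, fun m' hm' => ?_, ⟨(wordCons _ _ _).trans
        (((OrderIso.refl _).sumLexCongr (OrderIso.emptySumLex.trans e)).trans f)⟩⟩
      -- Dropping an empty `0 · ℚ` merges its neighbours into `n + p`: here `n` already exceeds the
      -- multiplicity on the left, and `p` the one on the right.
      have hn := (goodWord_cons_cons.1 hm').1.1
      cases s with
      | nil => exact goodWord_singleton _
      | cons q s =>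
        have := (goodWord_cons_cons.1 h4).1.2
        exact goodWord_cons_cons.2 ⟨⟨by simp only at *; lia, by simp only at *; lia⟩, h1⟩
    · refine ⟨n, (m, p) :: s, h4, ?_, fun m' hm' => ?_, ⟨(wordCons _ _ _).trans
        (((OrderIso.refl _).sumLexCongr ((OrderIso.refl _).sumLexCongr e)).trans
          (wordCons n (m, p) s).symm)⟩⟩
      · intro q hq
        rcases List.mem_cons.1 hq with rfl | hq
        · exact hm
        · exact h2 q hq
      · exact goodWord_cons_cons.2 ⟨(goodWord_cons_cons.1 hm').1, h4⟩

end FiniteSums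

/-! ### Endpoints and runs of words -/

section WordRuns

theorem noMinOrder_wordTail {q : ℕ × ℕ} {t : List (ℕ × ℕ)} (hq : 0 < q.1) :
    NoMinOrder ((ℚ ×ₗ Fin q.1) ⊕ₗ wordOrd q.2 t) := by
  have : Nonempty (Fin q.1) := ⟨⟨0, hq⟩⟩
  have : NoMinOrder (ℚ ×ₗ Fin q.1) := inferInstance
  have : Nonempty (ℚ ×ₗ Fin q.1) := ⟨toLex (0, ⟨0, hq⟩)⟩
  infer_instance

theorem noMinOrder_word {t : List (ℕ × ℕ)} (ht : ∀ q ∈ t, 0 < q.1) :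
    NoMinOrder (wordOrd 0 t) := by
  cases t with
  | nil => exact ⟨fun a => Fin.elim0 a⟩
  | cons q t =>
    have := noMinOrder_wordTail (t := t) (ht q (by simp))
    exact noMinOrder_of_iso (OrderIso.emptySumLex.symm.trans (wordCons 0 q t).symm)

theorem noMaxOrder_wordTail {q : ℕ × ℕ} {t : List (ℕ × ℕ)} (ht : ∀ q ∈ t, 0 < q.1)
    (hq : 0 < q.1) (h : lastLen q.2 t = 0) : NoMaxOrder ((ℚ ×ₗ Fin q.1) ⊕ₗ wordOrd q.2 t) := by
  induction t generalizing q with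
  | nil =>
    obtain ⟨m, n⟩ := q
    obtain rfl : n = 0 := h
    have : Nonempty (Fin m) := ⟨⟨0, hq⟩⟩
    have : IsEmpty (wordOrd 0 []) := inferInstanceAs (IsEmpty (Fin 0))
    exact noMaxOrder_of_iso (OrderIso.sumLexEmpty (α := ℚ ×ₗ Fin m)).symm
  | cons q' t ih =>
    have hq' := ht q' (by simp)
    have := ih (fun q hq => ht q (by simp [hq])) hq' h
    have : Nonempty ((ℚ ×ₗ Fin q'.1) ⊕ₗ wordOrd q'.2 t) :=
      ⟨toLex (Sum.inl (toLex (0, ⟨0, hq'⟩)))⟩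
    have : NoMaxOrder (wordOrd q.2 (q' :: t)) := noMaxOrder_of_iso (wordCons q.2 q' t).symm
    have : Nonempty (wordOrd q.2 (q' :: t)) := ‹Nonempty _›.map fun x => toLex (Sum.inr x)
    infer_instance

theorem noMaxOrder_word {n : ℕ} {t : List (ℕ × ℕ)} (ht : ∀ q ∈ t, 0 < q.1)
    (h : lastLen n t = 0) : NoMaxOrder (wordOrd n t) := by
  cases t with
  | nil =>
    obtain rfl : n = 0 := h
    exact ⟨fun a => Fin.elim0 a⟩
  | cons q t =>
    have hq := ht q (by simp)
    have := noMaxOrder_wordTail (fun q hq => ht q (by simp [hq])) hq h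
    have : Nonempty ((ℚ ×ₗ Fin q.1) ⊕ₗ wordOrd q.2 t) := ⟨toLex (Sum.inl (toLex (0, ⟨0, hq⟩)))⟩
    exact noMaxOrder_of_iso (wordCons n q t).symm

theorem runsLe_word {N n : ℕ} {t : List (ℕ × ℕ)} (ht : ∀ q ∈ t, 0 < q.1) (hn : n ≤ N)
    (h : ∀ q ∈ t, q.1 ≤ N ∧ q.2 ≤ N) : RunsLe (wordOrd n t) N := by
  induction t generalizing n with
  | nil => exact (runsLe_fin hn).of_iso (wordNil n).symm
  | cons q t ih =>
    have hmin := noMinOrder_wordTail (t := t) (ht q (by simp))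
    have : Nonempty (Fin q.1) := ⟨⟨0, ht q (by simp)⟩⟩
    have h1 := ih (fun q hq => ht q (by simp [hq])) (h q (by simp)).2
      fun q hq => h q (by simp [hq])
    exact ((runsLe_fin hn).sum ((((runsLe_prod q.1).mono (h q (by simp)).1)).sum h1
      (Or.inl inferInstance)) (Or.inr hmin)).of_iso (wordCons n q t).symm

theorem finite_runStarts_of_iso {A : Type u} {B : Type v} [LinearOrder A] [LinearOrder B] {N : ℕ}
    (e : A ≃o B) (h : (runStarts A N).Finite) : (runStarts B N).Finite := by
  rw [← encard_lt_top_iff] at h ⊢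
  exact (encard_runStarts_le (Le.of_iso e) N).trans_lt h

/-- The dense parts contain no run of length `M + 1`, so all such runs lie in the finitely many
finite chains. -/
theorem finite_runStarts_word {M n : ℕ} {t : List (ℕ × ℕ)} (ht : ∀ q ∈ t, 0 < q.1)
    (h : ∀ q ∈ t, q.1 ≤ M) : (runStarts (wordOrd n t) (M + 1)).Finite := by
  induction t generalizing n with
  | nil => exact finite_runStarts_of_iso (wordNil n).symm (toFinite _)
  | cons q t ih =>
    have hmin := noMinOrder_wordTail (t := t) (ht q (by simp))
    have : Nonempty (Fin q.1) := ⟨⟨0, ht q (by simp)⟩⟩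
    have h1 := ih (n := q.2) (fun q hq => ht q (by simp [hq])) fun q hq => h q (by simp [hq])
    have h2 : RunsLe (ℚ ×ₗ Fin q.1) M := (runsLe_prod q.1).mono (h q (by simp))
    refine finite_runStarts_of_iso (wordCons n q t).symm ?_
    rw [runStarts_sum (Or.inr hmin), runStarts_sum (Or.inl inferInstance), h2]
    exact ((toFinite _).image _).union (((finite_empty.image _).union (h1.image _)).image _)

end WordRuns

/-! ### Cutting at the first run of a given length -/

section Rigidity

variable {A : Type u} {B : Type v} [LinearOrder A] [LinearOrder B]

theorem eq_of_encard_Icc_eq {a b c : A} {N : ℕ} (hab : a ≤ b) (hac : a ≤ c)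
    (h : (Icc a b).encard = N) (h' : (Icc a c).encard = N) : b = c := by
  wlog hbc : b ≤ c generalizing b c
  · exact (this hac hab h' h (le_of_not_ge hbc)).symm
  have := (finite_of_encard_eq_coe h).eq_of_subset_of_encard_le
    (Icc_subset_Icc_right hbc) (by rw [h, h'])
  have hc : c ∈ Icc a b := by
    rw [this]
    exact ⟨hac, le_rfl⟩
  exact le_antisymm hbc hc.2

/-- At level three the first runs of length `N` correspond to each other. -/
theorem exists_rel_of_isLeast {N : ℕ} (h : Le 3 A B) {a b : A} {c d : B}
    (ha : IsLeast (runStarts A N) a) (hab : a ≤ b) (habN : (Icc a b).encard = N)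
    (hc : IsLeast (runStarts B N) c) (hcd : c ≤ d) (hcdN : (Icc c d).encard = N) {s : Set B}
    (hs : s.Finite) : ∃ r : Set (A × B), r.Finite ∧ s ⊆ Prod.snd '' r ∧ Bf 2 false r ∧
      (a, c) ∈ r ∧ (b, d) ∈ r := by
  obtain ⟨r, hr, h1, h2⟩ := le_succ_iff.1 h (s ∪ Icc c d)
    (hs.union (finite_of_encard_eq_coe hcdN))
  obtain ⟨⟨a', c'⟩, hp, rfl⟩ := h1 (Or.inr (left_mem_Icc.2 hcd))
  obtain ⟨⟨b', d'⟩, hq, rfl⟩ := h1 (Or.inr (right_mem_Icc.2 hcd))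
  have hab' : a' ≤ b' := (h2.partialIso _ hp _ hq).2 hcd
  have habN' : (Icc a' b').encard = N :=
    (encard_Icc_eq h2.of_succ hp hq (subset_union_right.trans h1)).trans hcdN
  -- The answer starts a run of length `N`, so it is not before `a`. Were it after `a`, challenging
  -- with the run `[a, b]` at the next level would produce a run of length `N` before `c`.
  have haa : a = a' := by
    refine le_antisymm (ha.2 ⟨b', hab', habN'⟩) (not_lt.1 fun hlt => ?_)
    obtain ⟨r', -, g1, g2, g3⟩ := h2 (Icc a b) (finite_of_encard_eq_coe habN)
    obtain ⟨⟨a'', z⟩, hz, rfl⟩ := g2 (left_mem_Icc.2 hab)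
    obtain ⟨⟨b'', w⟩, hw, rfl⟩ := g2 (right_mem_Icc.2 hab)
    have hzw : z ≤ w := (g3.partialIso _ hz _ hw).1 hab
    have hzN : (Icc z w).encard = N := by
      rw [← habN]
      exact le_antisymm ((linked_Icc hz hw).encard_le_of_bf_true g3)
        ((linked_Icc hz hw).encard_le' g3.partialIso le_rfl g2)
    exact ((g3.partialIso.lt_iff hz (g1 hp)).1 hlt).not_ge (hc.2 ⟨w, hzw, hzN⟩)
  subst haa
  obtain rfl := eq_of_encard_Icc_eq hab hab' habN habN'
  exact ⟨r, hr, subset_union_left.trans h1, h2, hp, hq⟩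

/-- Since the first runs must be matched, the parts before and after them are linked, and
`Bf.restrict` passes each answer to these parts without loss of level. -/
theorem le_three_Iio_Ioi {N : ℕ} (h : Le 3 A B) {a b : A} {c d : B}
    (ha : IsLeast (runStarts A N) a) (hab : a ≤ b) (habN : (Icc a b).encard = N)
    (hc : IsLeast (runStarts B N) c) (hcd : c ≤ d) (hcdN : (Icc c d).encard = N) :
    Le 3 (Iio a) (Iio c) ∧ Le 3 (Ioi b) (Ioi d) := by
  constructor
  all_goals
    refine le_succ_iff.2 fun s hs => ?_
    obtain ⟨r, hr, h1, h2, h3, h4⟩ := exists_rel_of_isLeast h ha hab habN hc hcd hcdN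
      (hs.image Subtype.val)
  · refine ⟨_, hr.preimage (Subtype.val_injective.prodMap Subtype.val_injective).injOn,
      fun y hy => ?_, h2.restrict (OrderEmbedding.subtype (· ∈ Iio a))
      (OrderEmbedding.subtype (· ∈ Iio c)) (by
        rw [OrderEmbedding.coe_subtype, OrderEmbedding.coe_subtype, Subtype.range_coe,
          Subtype.range_coe]
        exact linked_Iio h3)⟩
    obtain ⟨⟨z, y'⟩, hp, rfl⟩ := h1 (mem_image_of_mem _ hy)
    exact ⟨(⟨z, (h2.partialIso.lt_iff hp h3).2 y.2⟩, y), hp, rfl⟩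
  · refine ⟨_, hr.preimage (Subtype.val_injective.prodMap Subtype.val_injective).injOn,
      fun y hy => ?_, h2.restrict (OrderEmbedding.subtype (· ∈ Ioi b))
      (OrderEmbedding.subtype (· ∈ Ioi d)) (by
        rw [OrderEmbedding.coe_subtype, OrderEmbedding.coe_subtype, Subtype.range_coe,
          Subtype.range_coe]
        exact linked_Ioi h4)⟩
    obtain ⟨⟨z, y'⟩, hp, rfl⟩ := h1 (mem_image_of_mem _ hy)
    exact ⟨(⟨z, (h2.partialIso.lt_iff h4 hp).2 y.2⟩, y), hp, rfl⟩

end Rigidity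

/-! ### Words are determined by level three -/

section WordRigidity

/-- The sum of the lengths of the chains of a word. -/
def chainSum (n : ℕ) (t : List (ℕ × ℕ)) : ℕ := n + (t.map Prod.snd).sum

theorem chainSum_cons (n : ℕ) (q : ℕ × ℕ) (t : List (ℕ × ℕ)) :
    chainSum n (q :: t) = n + chainSum q.2 t := by
  simp [chainSum]

/-- A word splits at its first chain of maximal length. -/
theorem exists_split {N : ℕ} (hN : 0 < N) (n : ℕ) (t : List (ℕ × ℕ)) (ht : GoodWord t)
    (hpos : ∀ q ∈ t, 0 < q.1) (hlt : ∀ q ∈ t, q.1 < N ∧ q.2 ≤ N) (hn : n ≤ N)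
    (hex : n = N ∨ ∃ q ∈ t, q.2 = N) :
    ∃ p s s', GoodWord s ∧ GoodWord s' ∧ (∀ q ∈ s, 0 < q.1) ∧ (∀ q ∈ s', 0 < q.1) ∧
      p < N ∧ (∀ q ∈ s, q.1 < N ∧ q.2 < N) ∧ lastLen p s = 0 ∧
      chainSum p s < chainSum n t ∧ chainSum 0 s' < chainSum n t ∧
      (∀ m, GoodWord ((m, n) :: t) → GoodWord ((m, p) :: s)) ∧
      Nonempty (wordOrd p s ⊕ₗ (Fin N ⊕ₗ wordOrd 0 s') ≃o wordOrd n t) := by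
  by_cases hnN : n = N
  · subst hnN
    obtain ⟨e⟩ := nonempty_finSumWord n 0 t
    exact ⟨0, [], t, goodWord_nil, ht, by simp, hpos, hN, by simp, rfl, by simp [chainSum, hN],
      by simp [chainSum, hN], fun m _ => goodWord_singleton _,
      ⟨((wordNil 0).sumLexCongr e).trans OrderIso.emptySumLex⟩⟩
  have hn' : n < N := lt_of_le_of_ne hn hnN
  induction t generalizing n with
  | nil => simp [hnN] at hex
  | cons q t ih =>
    have hq := hlt q (by simp)
    -- The same splitting for the tail, whose first chain either is itself the first longest chain
    -- or lets the induction continue.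
    have key : ∃ p s s', GoodWord s ∧ GoodWord s' ∧ (∀ q ∈ s, 0 < q.1) ∧ (∀ q ∈ s', 0 < q.1) ∧
        p < N ∧ (∀ q ∈ s, q.1 < N ∧ q.2 < N) ∧ lastLen p s = 0 ∧
        chainSum p s < chainSum q.2 t ∧ chainSum 0 s' < chainSum q.2 t ∧
        (∀ m, GoodWord ((m, q.2) :: t) → GoodWord ((m, p) :: s)) ∧
        Nonempty (wordOrd p s ⊕ₗ (Fin N ⊕ₗ wordOrd 0 s') ≃o wordOrd q.2 t) := by
      by_cases hqN : q.2 = N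
      · obtain ⟨e⟩ := nonempty_finSumWord q.2 0 t
        exact ⟨0, [], t, goodWord_nil, ht.tail, by simp, fun q hq => hpos q (by simp [hq]), hN,
          by simp, rfl, by simp [chainSum, hqN, hN],
          by simp [chainSum, hqN, hN], fun m _ => goodWord_singleton _,
          ⟨((wordNil 0).sumLexCongr (((Fin.castOrderIso hqN.symm).sumLexCongr
            (OrderIso.refl _)).trans e)).trans OrderIso.emptySumLex⟩⟩
      · refine ih q.2 ht.tail (fun q hq => hpos q (by simp [hq])) (fun q hq => hlt q (by simp [hq]))
          hq.2 ?_ hqN (lt_of_le_of_ne hq.2 hqN)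
        rcases hex with h | ⟨r, hr, hrN⟩
        · exact absurd h hnN
        · rcases List.mem_cons.1 hr with rfl | hr
          · exact Or.inl hrN
          · exact Or.inr ⟨r, hr, hrN⟩
    obtain ⟨p, s, s', h1, h2, h3, h4, h5, h6, h7, h8, h9, h10, ⟨e⟩⟩ := key
    have hg := h10 q.1 ht
    refine ⟨n, (q.1, p) :: s, s', hg, h2, ?_, h4, hn', ?_, h7, ?_, ?_, fun m hm => ?_, ?_⟩
    · intro r hr
      rcases List.mem_cons.1 hr with rfl | hr
      · exact hpos q (by simp)
      · exact h3 r hr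
    · intro r hr
      rcases List.mem_cons.1 hr with rfl | hr
      · exact ⟨hq.1, h5⟩
      · exact h6 r hr
    · rw [chainSum_cons, chainSum_cons]
      simpa using h8
    · rw [chainSum_cons]
      lia
    · exact goodWord_cons_cons.2 ⟨(goodWord_cons_cons.1 hm).1, hg⟩
    · exact ⟨((wordCons n (q.1, p) s).sumLexCongr (OrderIso.refl _)).trans
        ((OrderIso.sumLexAssoc _ _ _).trans (((OrderIso.refl _).sumLexCongr
        ((OrderIso.sumLexAssoc _ _ _).trans ((OrderIso.refl _).sumLexCongr e))).trans
        (wordCons n q t).symm))⟩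

/-- In a word with at least two letters every multiplicity is adjacent to an inner chain, which is
longer. -/
theorem GoodWord.eq_singleton_or {t : List (ℕ × ℕ)} (ht : GoodWord t) {q : ℕ × ℕ} (hq : q ∈ t) :
    t = [q] ∨ ∃ p ∈ t, q.1 < p.2 := by
  induction t with
  | nil => simp at hq
  | cons p t ih =>
    cases t with
    | nil => exact Or.inl (by rw [List.mem_singleton.1 hq])
    | cons r t =>
      have h := goodWord_cons_cons.1 ht
      rcases List.mem_cons.1 hq with rfl | hq
      · exact Or.inr ⟨q, by simp, h.1.1⟩
      · rcases ih h.2 hq with h' | ⟨p', hp', h'⟩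
        · obtain ⟨rfl, -⟩ := List.cons.inj h'
          exact Or.inr ⟨p, by simp, h.1.2⟩
        · exact Or.inr ⟨p', by simp [hp'], h'⟩

/-- Either the whole word is `n + m · ℚ + n'` with `n, n' ≤ m`, or some chain is at least as long as
all others and longer than all multiplicities. -/
theorem GoodWord.dichotomy (n : ℕ) {t : List (ℕ × ℕ)} (ht : GoodWord t) (hne : t ≠ []) :
    (∃ q : ℕ × ℕ, t = [q] ∧ n ≤ q.1 ∧ q.2 ≤ q.1) ∨
      ∃ N, 0 < N ∧ (∀ q ∈ t, q.1 < N ∧ q.2 ≤ N) ∧ n ≤ N ∧ (n = N ∨ ∃ q ∈ t, q.2 = N) := by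
  obtain ⟨N, hN, hmax⟩ : ∃ N, (n = N ∨ ∃ q ∈ t, q.2 = N) ∧ n ≤ N ∧ ∀ q ∈ t, q.2 ≤ N := by
    obtain ⟨x, hx, hmax⟩ := (n :: t.map Prod.snd).toFinset.exists_max_image id ⟨n, by simp⟩
    refine ⟨x, ?_, hmax n (by simp), fun q hq => hmax q.2 ?_⟩
    · simp only [List.mem_toFinset, List.mem_cons, List.mem_map] at hx
      exact hx.imp Eq.symm id
    · simp only [List.mem_toFinset, List.mem_cons, List.mem_map]
      exact Or.inr ⟨q, hq, rfl⟩
  by_cases h : ∀ q ∈ t, q.1 < N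
  · obtain ⟨q, hq⟩ := List.exists_mem_of_ne_nil t hne
    exact Or.inr ⟨N, (Nat.zero_le _).trans_lt (h q hq), fun q hq => ⟨h q hq, hmax.2 q hq⟩,
      hmax.1, hN⟩
  · push Not at h
    obtain ⟨q, hq, hqN⟩ := h
    rcases ht.eq_singleton_or hq with rfl | ⟨p, hp, hqp⟩
    · exact Or.inl ⟨q, rfl, hmax.1.trans hqN, (hmax.2 q hq).trans hqN⟩
    · exact absurd (hqp.trans_le (hmax.2 p hp)) hqN.not_gt

variable {A : Type u} {B : Type v} [LinearOrder A] [LinearOrder B]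

theorem runsLe_iff_of_le_three (h : Le 3 A B) (N : ℕ) : RunsLe A N ↔ RunsLe B N :=
  ⟨RunsLe.of_le h.of_succ, RunsLe.of_le h.symm_of_succ⟩

theorem hasInit_iff_of_le_three (h : Le 3 A B) (l : ℕ) : HasInit A l ↔ HasInit B l :=
  ⟨HasInit.of_le h.symm_of_succ, HasInit.of_le h.of_succ⟩

theorem InitIs.of_le_three (h : Le 3 A B) {c : ℕ∞} (hc : InitIs A c) : InitIs B c :=
  fun l => (hasInit_iff_of_le_three h l).symm.trans (hc l)

theorem encard_runStarts_eq_of_le_three (h : Le 3 A B) (N : ℕ) :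
    (runStarts A N).encard = (runStarts B N).encard :=
  le_antisymm (encard_runStarts_le h.symm_of_succ N) (encard_runStarts_le h.of_succ N)

theorem nonempty_orderIso_of_finite [Finite A] (h : Le 2 A B) : Nonempty (A ≃o B) := by
  have h1 : (univ : Set A).encard = ((univ : Set A).ncard : ℕ) := (finite_univ.cast_ncard_eq).symm
  obtain ⟨e⟩ := nonempty_orderIso_fin_of_encard h1
  obtain ⟨f⟩ := nonempty_orderIso_fin_of_encard (h.encard_univ_eq.symm.trans h1)
  exact ⟨OrderIso.Set.univ.symm.trans (e.trans (f.symm.trans OrderIso.Set.univ))⟩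

/-- The position of the first run of maximal length in a sum of the form `X + N + Y`. -/
theorem isLeast_runStarts_sum {M : ℕ} {X : Type u} {Y : Type v} [LinearOrder X] [LinearOrder Y]
    (hX : RunsLe X M) [NoMaxOrder X] [NoMinOrder Y] :
    ∃ a b : X ⊕ₗ (Fin (M + 1) ⊕ₗ Y), IsLeast (runStarts (X ⊕ₗ (Fin (M + 1) ⊕ₗ Y)) (M + 1)) a ∧
      a ≤ b ∧ (Icc a b).encard = (M + 1 : ℕ) ∧ Nonempty (X ≃o Iio a) ∧ Nonempty (Y ≃o Ioi b) := by
  let g : Fin (M + 1) ↪o X ⊕ₗ (Fin (M + 1) ⊕ₗ Y) :=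
    (inlEmb (Fin (M + 1)) Y).trans (inrEmb X (Fin (M + 1) ⊕ₗ Y))
  let y : Y ↪o X ⊕ₗ (Fin (M + 1) ⊕ₗ Y) :=
    (inrEmb (Fin (M + 1)) Y).trans (inrEmb X (Fin (M + 1) ⊕ₗ Y))
  have hab : g 0 ≤ g (Fin.last M) := g.le_iff_le.2 (Fin.zero_le _)
  have huniv : Icc (0 : Fin (M + 1)) (Fin.last M) = univ :=
    eq_univ_of_forall fun i => ⟨Fin.zero_le _, Fin.le_last _⟩
  have hcard : (Icc (g 0) (g (Fin.last M))).encard = (M + 1 : ℕ) := by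
    refine (encard_Icc_of_ordConnected (inrEmb X (Fin (M + 1) ⊕ₗ Y)) ordConnected_range_inrEmb
      (inlEmb _ _ 0) (inlEmb _ _ (Fin.last M))).trans ((encard_Icc_of_ordConnected
        (inlEmb (Fin (M + 1)) Y) ordConnected_range_inlEmb 0 (Fin.last M)).trans ?_)
    rw [huniv]
    simp
  refine ⟨g 0, g (Fin.last M), ⟨⟨g (Fin.last M), hab, hcard⟩, ?_⟩, hab, hcard, ?_, ?_⟩
  · rw [runStarts_sum (Or.inl inferInstance), hX]
    rintro _ (⟨_, h, -⟩ | ⟨z, -, rfl⟩)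
    · exact h.elim
    · refine (inrEmb X (Fin (M + 1) ⊕ₗ Y)).le_iff_le.2 ?_
      obtain ⟨z | z, rfl⟩ := toLex.surjective z
      · exact Sum.Lex.inl_le_inl_iff.2 (Fin.zero_le _)
      · exact Sum.Lex.inl_le_inr _ _
  · have hr : range (inlEmb X (Fin (M + 1) ⊕ₗ Y)) = Iio (g 0) := by
      ext z
      constructor
      · rintro ⟨x, rfl⟩
        exact Sum.Lex.inl_lt_inr _ _
      · intro hz
        obtain ⟨z | z, rfl⟩ := toLex.surjective z
        · exact ⟨z, rfl⟩
        · exfalso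
          have hz : z < toLex (Sum.inl 0) := Sum.Lex.inr_lt_inr_iff.1 hz
          obtain ⟨z | z, rfl⟩ := toLex.surjective z
          · exact (Fin.zero_le z).not_gt (Sum.Lex.inl_lt_inl_iff.1 hz)
          · exact Sum.Lex.not_inr_lt_inl hz
    exact ⟨(inlEmb X (Fin (M + 1) ⊕ₗ Y)).orderIso.trans (OrderIso.setCongr _ _ hr)⟩
  · have hr : range y = Ioi (g (Fin.last M)) := by
      ext z
      constructor
      · rintro ⟨x, rfl⟩
        exact (inrEmb X (Fin (M + 1) ⊕ₗ Y)).lt_iff_lt.2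
          (Sum.Lex.inl_lt_inr (Fin.last M) x)
      · intro hz
        obtain ⟨z | z, rfl⟩ := toLex.surjective z
        · exact (Sum.Lex.not_inr_lt_inl hz).elim
        · have hz : toLex (Sum.inl (Fin.last M)) < z := Sum.Lex.inr_lt_inr_iff.1 hz
          obtain ⟨z | z, rfl⟩ := toLex.surjective z
          · exact ((Fin.le_last z).not_gt (Sum.Lex.inl_lt_inl_iff.1 hz)).elim
          · exact ⟨z, rfl⟩
    exact ⟨y.orderIso.trans (OrderIso.setCongr _ _ hr)⟩

/-- The structure of a word in the second case of `GoodWord.dichotomy`. -/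
theorem exists_maximal_chain {M n : ℕ} {t : List (ℕ × ℕ)}
    (ht : GoodWord t) (hpos : ∀ q ∈ t, 0 < q.1) (hlt : ∀ q ∈ t, q.1 < M + 1 ∧ q.2 ≤ M + 1)
    (hn : n ≤ M + 1) (hex : n = M + 1 ∨ ∃ q ∈ t, q.2 = M + 1) :
    ∃ p s s', GoodWord s ∧ GoodWord s' ∧ (∀ q ∈ s, 0 < q.1) ∧ (∀ q ∈ s', 0 < q.1) ∧
      chainSum p s < chainSum n t ∧ chainSum 0 s' < chainSum n t ∧
      RunsLe (wordOrd p s) M ∧ NoMaxOrder (wordOrd p s) ∧ NoMinOrder (wordOrd 0 s') ∧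
      Nonempty (wordOrd p s ⊕ₗ (Fin (M + 1) ⊕ₗ wordOrd 0 s') ≃o wordOrd n t) := by
  obtain ⟨p, s, s', h1, h2, h3, h4, h5, h6, h7, h8, h9, -, e⟩ :=
    exists_split M.succ_pos n t ht hpos hlt hn hex
  exact ⟨p, s, s', h1, h2, h3, h4, h8, h9, runsLe_word h3 (Nat.lt_succ_iff.1 h5)
    fun q hq => ⟨Nat.lt_succ_iff.1 (h6 q hq).1, Nat.lt_succ_iff.1 (h6 q hq).2⟩,
    noMaxOrder_word h3 h7, noMinOrder_word h4, e⟩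

/-- Since `X` and `X'` have no run of length `M + 1`, the displayed chains are the first such runs,
so they can be cancelled. -/
theorem le_three_summands {M : ℕ} {X X' : Type u} {Y Y' : Type v} [LinearOrder X] [LinearOrder Y]
    [LinearOrder X'] [LinearOrder Y'] (hX : RunsLe X M) (hX' : RunsLe X' M) [NoMaxOrder X]
    [NoMinOrder Y] [NoMaxOrder X'] [NoMinOrder Y']
    (h : Le 3 (X ⊕ₗ (Fin (M + 1) ⊕ₗ Y)) (X' ⊕ₗ (Fin (M + 1) ⊕ₗ Y'))) : Le 3 X X' ∧ Le 3 Y Y' := by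
  obtain ⟨a, b, g1, g2, g3, ⟨f⟩, ⟨g⟩⟩ := isLeast_runStarts_sum (Y := Y) hX
  obtain ⟨a', b', g1', g2', g3', ⟨f'⟩, ⟨g'⟩⟩ := isLeast_runStarts_sum (Y := Y') hX'
  obtain ⟨h1, h2⟩ := le_three_Iio_Ioi h g1 g2 g3 g1' g2' g3'
  exact ⟨h1.map f.symm f'.symm, h2.map g.symm g'.symm⟩

theorem nonempty_runStarts_of_iso {N : ℕ} (e : A ≃o B) (h : (runStarts A N).Nonempty) :
    (runStarts B N).Nonempty := by
  rw [← encard_pos] at h ⊢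
  exact h.trans_le (encard_runStarts_le (Le.of_iso e.symm) N)

theorem initIs_word {n : ℕ} {q : ℕ × ℕ} {t : List (ℕ × ℕ)} (hq : 0 < q.1) :
    InitIs (wordOrd n (q :: t)) n :=
  have := noMinOrder_wordTail (t := t) hq
  (initIs_fin_sum n).of_iso (wordCons n q t).symm

theorem finalIs_word_singleton {n : ℕ} {q : ℕ × ℕ} (hq : 0 < q.1) :
    InitIs (wordOrd n [q])ᵒᵈ q.2 := by
  have : Nonempty (Fin q.1) := ⟨⟨0, hq⟩⟩
  have : Nonempty (ℚ ×ₗ Fin q.1) := ⟨toLex (0, ⟨0, hq⟩)⟩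
  exact (finalIs_sum_fin (X := Fin n ⊕ₗ (ℚ ×ₗ Fin q.1)) q.2).of_iso
    ((OrderIso.sumLexAssoc _ _ _).trans (wordCons n q []).symm).dual

theorem infinite_runStarts_word {n M k : ℕ} :
    (runStarts (wordOrd n [(M + 1, k)]) (M + 1)).Infinite := by
  have := noMinOrder_wordTail (q := (M + 1, k)) (t := []) M.succ_pos
  intro hf
  have h1 := finite_runStarts_of_iso (wordCons n (M + 1, k) []) hf
  rw [runStarts_sum (Or.inr this), runStarts_sum (Or.inl inferInstance)] at h1
  have h2 := (h1.subset subset_union_right).of_finite_image (inrEmb _ _).injective.injOn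
  have h3 := (h2.subset subset_union_left).of_finite_image (inlEmb _ _).injective.injOn
  exact infinite_runStarts_prod M h3

/-- Words with positive multiplicities are determined up to isomorphism by `≤₃`. -/
theorem nonempty_iso_of_le_three_word {n n' : ℕ} {t t' : List (ℕ × ℕ)} (ht : GoodWord t)
    (ht' : GoodWord t') (hpos : ∀ q ∈ t, 0 < q.1) (hpos' : ∀ q ∈ t', 0 < q.1)
    (h : Le 3 (wordOrd n t) (wordOrd n' t')) : Nonempty (wordOrd n t ≃o wordOrd n' t') := by
  -- Both remainders after removing a longest chain have a smaller chain sum.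
  induction hc : chainSum n' t' using Nat.strong_induction_on generalizing n n' t t' with
  | _ c ih =>
  subst hc
  rcases eq_or_ne t [] with rfl | hne
  · have : Finite (wordOrd n []) := inferInstanceAs (Finite (Fin n))
    exact nonempty_orderIso_of_finite h.of_succ
  rcases eq_or_ne t' [] with rfl | hne'
  · have : Finite (wordOrd n' []) := inferInstanceAs (Finite (Fin n'))
    exact (nonempty_orderIso_of_finite h.symm_of_succ).map OrderIso.symm
  -- The greatest run length is the same on both sides, because `≤₃` preserves every bound on runs.
  have maxRun : ∀ {M M' : ℕ}, RunsLe (wordOrd n t) (M + 1) →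
      (runStarts (wordOrd n t) (M + 1)).Nonempty → RunsLe (wordOrd n' t') (M' + 1) →
      (runStarts (wordOrd n' t') (M' + 1)).Nonempty → M = M' := by
    intro M M' h1 h2 h3 h4
    have h5 := (runsLe_iff_le h1 h2).1 ((runsLe_iff_of_le_three h _).2 h3)
    have h6 := (runsLe_iff_le h3 h4).1 ((runsLe_iff_of_le_three h _).1 h1)
    lia
  have single : ∀ {n : ℕ} {q : ℕ × ℕ}, 0 < q.1 → n ≤ q.1 → q.2 ≤ q.1 → ∃ M, q.1 = M + 1 ∧
      RunsLe (wordOrd n [q]) (M + 1) ∧ (runStarts (wordOrd n [q]) (M + 1)).Infinite := by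
    rintro n ⟨m, k⟩ h1 h2 h3
    obtain ⟨M, rfl⟩ := Nat.exists_eq_succ_of_ne_zero h1.ne'
    exact ⟨M, rfl, runsLe_word (by simp) h2 (by simpa using h3), infinite_runStarts_word⟩
  have multi : ∀ {n N : ℕ} {t : List (ℕ × ℕ)}, GoodWord t → (∀ q ∈ t, 0 < q.1) → 0 < N →
      (∀ q ∈ t, q.1 < N ∧ q.2 ≤ N) → n ≤ N → (n = N ∨ ∃ q ∈ t, q.2 = N) → ∃ M, N = M + 1 ∧
      RunsLe (wordOrd n t) (M + 1) ∧ (runStarts (wordOrd n t) (M + 1)).Nonempty ∧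
      (runStarts (wordOrd n t) (M + 1)).Finite := by
    intro n N t h1 h2 h3 h4 h5 h6
    obtain ⟨M, rfl⟩ := Nat.exists_eq_succ_of_ne_zero h3.ne'
    obtain ⟨p, s, s', -, -, -, -, -, -, g1, g2, g3, ⟨e⟩⟩ := exists_maximal_chain h1 h2 h4 h5 h6
    obtain ⟨a, b, ha, -⟩ := isLeast_runStarts_sum (Y := wordOrd 0 s') g1
    exact ⟨M, rfl, runsLe_word h2 h5 fun q hq => ⟨(h4 q hq).1.le, (h4 q hq).2⟩,
      nonempty_runStarts_of_iso e ⟨a, ha.1⟩,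
      finite_runStarts_word h2 fun q hq => Nat.lt_succ_iff.1 (h4 q hq).1⟩
  rcases ht.dichotomy n hne with ⟨q, rfl, hq1, hq2⟩ | ⟨N, hN, hlt, hn, hex⟩ <;>
    rcases ht'.dichotomy n' hne' with ⟨q', rfl, hq1', hq2'⟩ | ⟨N', hN', hlt', hn', hex'⟩
  · obtain ⟨M, hM, g1, g2⟩ := single (hpos q (by simp)) hq1 hq2
    obtain ⟨M', hM', g1', g2'⟩ := single (hpos' q' (by simp)) hq1' hq2'
    obtain rfl := maxRun g1 g2.nonempty g1' g2'.nonempty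
    have h1 := ((initIs_word (hpos q (by simp))).of_le_three h).unique
      (initIs_word (hpos' q' (by simp)))
    have h2 := ((finalIs_word_singleton (hpos q (by simp))).of_le_three h.dual).unique
      (finalIs_word_singleton (hpos' q' (by simp)))
    obtain rfl : n = n' := by exact_mod_cast h1
    obtain rfl : q = q' := Prod.ext (hM.trans hM'.symm) (by exact_mod_cast h2)
    exact ⟨OrderIso.refl _⟩
  · obtain ⟨M, hM, g1, g2⟩ := single (hpos q (by simp)) hq1 hq2
    obtain ⟨M', hM', g1', g2', g3'⟩ := multi ht' hpos' hN' hlt' hn' hex'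
    obtain rfl := maxRun g1 g2.nonempty g1' g2'
    -- The mixed cases are impossible: a single dense block has infinitely many longest runs, a word
    -- with a dominating chain only finitely many.
    have := encard_runStarts_eq_of_le_three h (M + 1)
    rw [g2.encard_eq, eq_comm, encard_eq_top_iff] at this
    exact absurd g3' this
  · obtain ⟨M, hM, g1, g2, g3⟩ := multi ht hpos hN hlt hn hex
    obtain ⟨M', hM', g1', g2'⟩ := single (hpos' q' (by simp)) hq1' hq2'
    obtain rfl := maxRun g1 g2 g1' g2'.nonempty
    have := encard_runStarts_eq_of_le_three h (M + 1)
    rw [g2'.encard_eq, encard_eq_top_iff] at this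
    exact absurd g3 this
  · obtain ⟨M, rfl, g1, g2, -⟩ := multi ht hpos hN hlt hn hex
    obtain ⟨M', rfl, g1', g2', -⟩ := multi ht' hpos' hN' hlt' hn' hex'
    obtain rfl := maxRun g1 g2 g1' g2'
    obtain ⟨p, s, s₂, a1, a2, a3, a4, -, -, a7, _, _, ⟨e⟩⟩ :=
      exists_maximal_chain ht hpos hlt hn hex
    obtain ⟨p', s', s₂', b1, b2, b3, b4, b5, b6, b7, _, _, ⟨e'⟩⟩ :=
      exists_maximal_chain ht' hpos' hlt' hn' hex'
    obtain ⟨h1, h2⟩ := le_three_summands a7 b7 (h.map e.symm e'.symm)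
    obtain ⟨f⟩ := ih _ b5 a1 b1 a3 b3 h1 rfl
    obtain ⟨g⟩ := ih _ b6 a2 b2 a4 b4 h2 rfl
    exact ⟨e.symm.trans ((f.sumLexCongr ((OrderIso.refl _).sumLexCongr g)).trans e')⟩

end WordRigidity

/-! ### Invariance, universality and minimality of `K` -/

section Main

theorem leAlpha_three_iff {A B : LinOrd.{u}} : LeAlpha 3 A B ↔ Le 3 A B := by
  have h := backForth_natCast_iff (A := A) (B := B) 3 Fin.elim0 Fin.elim0
  rw [range_eq_empty] at h
  exact h

theorem UnboundedModel.initIs {c d : ℕ∞} {B : Type u} [LinearOrder B]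
    (h : UnboundedModel c d B) : InitIs B c ∧ InitIs Bᵒᵈ d := by
  have top : ∀ {A : Type} [LinearOrder A], (∀ l, HasInit A l) → InitIs A ⊤ :=
    fun h l => by simp [h l]
  have hnat : ∀ {A : Type} [LinearOrder A], InitIs (ℕ ⊕ₗ A) ⊤ :=
    top fun l => (hasInit_nat l).sum_left
  have hdual : ∀ {A : Type} [LinearOrder A], InitIs (A ⊕ₗ ℕᵒᵈ)ᵒᵈ ⊤ :=
    fun {A} _ => top fun l => (HasInit.sum_left (Y := Aᵒᵈ) (hasInit_natDual_dual l)).of_iso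
      (OrderIso.sumLexDualAntidistrib A ℕᵒᵈ).symm
  rcases h with ⟨rfl, rfl, ⟨e⟩⟩ | ⟨k, rfl, rfl, ⟨e⟩⟩ | ⟨k, rfl, rfl, ⟨e⟩⟩ |
    ⟨k, k', rfl, rfl, ⟨e⟩⟩
  · exact ⟨hnat.of_iso e.symm, hdual.of_iso e.symm.dual⟩
  · exact ⟨hnat.of_iso e.symm, (finalIs_sum_fin k).of_iso e.symm.dual⟩
  · exact ⟨(initIs_fin_sum k).of_iso e.symm, hdual.of_iso e.symm.dual⟩
  · exact ⟨(initIs_fin_sum k).of_iso ((OrderIso.sumLexAssoc _ _ _).symm.trans e.symm),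
      (finalIs_sum_fin k').of_iso e.symm.dual⟩

theorem not_runsLe_int (N : ℕ) : ¬ RunsLe ℤ N := fun h => by
  have h1 := h.encard_le (toFinite (Icc (0 : ℤ) N))
  rw [encard_eq_coe_toFinset_card] at h1
  have h2 : ((N + 1 : ℕ) : ℕ∞) ≤ N := by simpa using h1
  exact absurd (Nat.cast_le.1 h2) (by simp)

/-- A bound would make both end runs finite, leaving only `k + ℤ + k'`, which contains `ℤ` as a
convex part. -/
theorem UnboundedModel.not_runsLe {c d : ℕ∞} {B : Type u} [LinearOrder B]
    (h : UnboundedModel c d B) (N : ℕ) : ¬ RunsLe B N := by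
  intro hN
  obtain ⟨hc, hd⟩ := h.initIs
  obtain ⟨k, rfl⟩ := hc.exists_natCast hN
  obtain ⟨k', rfl⟩ := hd.exists_natCast (runsLe_dual hN)
  rcases h with ⟨h, -⟩ | ⟨k, h, -⟩ | ⟨k, -, h, -⟩ | ⟨k, k', -, -, ⟨e⟩⟩
  · exact ENat.natCast_ne_top _ h
  · exact ENat.natCast_ne_top _ h
  · exact ENat.natCast_ne_top _ h
  · exact not_runsLe_int N (((hN.of_iso e).of_ordConnected (inlEmb _ _)
      ordConnected_range_inlEmb).of_ordConnected (inrEmb _ _) ordConnected_range_inrEmb)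

theorem UnboundedModel.nonempty_orderIso {c d : ℕ∞} {A B : Type u} [LinearOrder A] [LinearOrder B]
    (h : UnboundedModel c d A) (h' : UnboundedModel c d B) : Nonempty (A ≃o B) := by
  rcases h with ⟨rfl, rfl, ⟨e⟩⟩ | ⟨k, rfl, rfl, ⟨e⟩⟩ | ⟨k, rfl, rfl, ⟨e⟩⟩ |
    ⟨k, k', rfl, rfl, ⟨e⟩⟩ <;>
  rcases h' with ⟨h1, h2, ⟨f⟩⟩ | ⟨l, h1, h2, ⟨f⟩⟩ | ⟨l, h1, h2, ⟨f⟩⟩ | ⟨l, l', h1, h2, ⟨f⟩⟩ <;>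
  simp only [ENat.natCast_ne_top, ENat.top_ne_natCast, Nat.cast_inj] at h1 h2 <;>
  subst_vars <;> exact ⟨e.trans f.symm⟩

theorem exists_model_of_mem_K {B : LinOrd.{u}} (h : B ∈ K.{u}) :
    (∃ c d, UnboundedModel c d B) ∨ ∃ n t, GoodWord t ∧ (∀ q ∈ t, 0 < q.1) ∧
      Nonempty (B ≃o wordOrd n t) := by
  rcases h with ⟨k, e⟩ | ⟨k, e⟩ | ⟨k, k', e⟩ | e | ⟨k, n, m, hi, ⟨e⟩⟩ | ⟨k, ⟨e⟩⟩
  · exact Or.inl ⟨_, _, Or.inr (Or.inl ⟨k, rfl, rfl, e⟩)⟩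
  · exact Or.inl ⟨_, _, Or.inr (Or.inr (Or.inl ⟨k, rfl, rfl, e⟩))⟩
  · exact Or.inl ⟨_, _, Or.inr (Or.inr (Or.inr ⟨k, k', rfl, rfl, e⟩))⟩
  · exact Or.inl ⟨_, _, Or.inl ⟨rfl, rfl, e⟩⟩
  · obtain ⟨f⟩ := nonempty_finiteSum_iso k n m
    obtain ⟨p, s, h1, h2, -, ⟨g⟩⟩ := exists_positive (n 0) _ (goodWord_toList.2 hi)
    exact Or.inr ⟨p, s, h1, h2, ⟨e.trans (f.trans g)⟩⟩
  · exact Or.inr ⟨k, [], goodWord_nil, by simp, ⟨e.trans (wordNil k).symm⟩⟩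

theorem mem_K_of_unboundedModel {B : LinOrd.{u}} {c d : ℕ∞} (h : UnboundedModel c d B) :
    B ∈ K.{u} := by
  rcases h with ⟨-, -, e⟩ | ⟨k, -, -, e⟩ | ⟨k, -, -, e⟩ | ⟨k, k', -, -, e⟩
  · exact Or.inr (Or.inr (Or.inr (Or.inl e)))
  · exact Or.inl ⟨k, e⟩
  · exact Or.inr (Or.inl ⟨k, e⟩)
  · exact Or.inr (Or.inr (Or.inl ⟨k, k', e⟩))

theorem mem_K_of_word {B : LinOrd.{u}} {n : ℕ} {t : List (ℕ × ℕ)} (ht : GoodWord t)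
    (e : B ≃o wordOrd n t) : B ∈ K.{u} := by
  obtain ⟨k, f, g, rfl, rfl⟩ := exists_toList_eq n t
  obtain ⟨e'⟩ := nonempty_finiteSum_iso k f g
  exact Or.inr (Or.inr (Or.inr (Or.inr (Or.inl
    ⟨k, f, g, goodWord_toList.1 ht, ⟨e.trans e'.symm⟩⟩))))

/-- Members of `K` that are comparable at level three are isomorphic. -/
theorem nonempty_iso_of_mem_K {A B : LinOrd.{u}} (hA : A ∈ K.{u}) (hB : B ∈ K.{u})
    (h : Le 3 A B) : Nonempty (A ≃o B) := by
  have bounded : ∀ {C : LinOrd.{u}} {n : ℕ} {t : List (ℕ × ℕ)}, (∀ q ∈ t, 0 < q.1) →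
      (C ≃o wordOrd n t) → ∃ N, RunsLe C N := by
    intro C n t ht e
    -- A crude bound that dominates every chain and every multiplicity.
    let N := n + (t.map Prod.fst).sum + (t.map Prod.snd).sum
    refine ⟨N, (runsLe_word ht (by lia) fun q hq => ?_).of_iso e.symm⟩
    have h1 := List.le_sum_of_mem (List.mem_map_of_mem (f := Prod.fst) hq)
    have h2 := List.le_sum_of_mem (List.mem_map_of_mem (f := Prod.snd) hq)
    constructor <;> lia
  rcases exists_model_of_mem_K hA with ⟨c, d, hm⟩ | ⟨n, t, h1, h2, ⟨e⟩⟩ <;>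
    rcases exists_model_of_mem_K hB with ⟨c', d', hm'⟩ | ⟨n', t', h1', h2', ⟨e'⟩⟩
  · obtain rfl := (hm.initIs.1.of_le_three h).unique hm'.initIs.1
    obtain rfl := (hm.initIs.2.of_le_three h.dual).unique hm'.initIs.2
    exact hm.nonempty_orderIso hm'
  · obtain ⟨N, hN⟩ := bounded h2' e'
    exact absurd ((runsLe_iff_of_le_three h N).2 hN) (hm.not_runsLe N)
  · obtain ⟨N, hN⟩ := bounded h2 e
    exact absurd ((runsLe_iff_of_le_three h N).1 hN) (hm'.not_runsLe N)
  · obtain ⟨f⟩ := nonempty_iso_of_le_three_word h1 h1' h2 h2' (h.map e e')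
    exact ⟨e.trans (f.trans e'.symm)⟩

theorem isUniversal_three_K (C : Set LinOrd.{u}) : IsUniversal 3 K.{u} C := by
  intro A _
  suffices H : ∃ (B : Type) (_ : LinearOrder B),
      (∀ L : LinOrd.{u}, Nonempty (L ≃o B) → L ∈ K.{u}) ∧ Le 3 A B by
    obtain ⟨B, _, h1, h2⟩ := H
    -- The models live in the lowest universe and are lifted to that of `A`.
    let e : LinOrd.of (ULift.{u} B) ≃o B := ULift.orderIso
    exact ⟨LinOrd.of (ULift.{u} B), h1 _ ⟨e⟩, leAlpha_three_iff.2 (h2.map (OrderIso.refl _) e.symm)⟩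
  by_cases hb : ∃ N, RunsLe A N
  · obtain ⟨N, hN⟩ := hb
    obtain ⟨n, t, h1, -, h2⟩ := exists_word_of_runsLe N A hN
    exact ⟨wordOrd n t, inferInstance, fun L ⟨e⟩ => mem_K_of_word h1 e, h2⟩
  · push Not at hb
    have : Infinite A := by
      by_contra hf
      rw [not_infinite_iff_finite] at hf
      refine hb (univ : Set A).ncard (runsLe_of_encard_le fun a b _ => ?_)
      rw [finite_univ.cast_ncard_eq]
      exact encard_le_encard (subset_univ _)
    obtain ⟨B, _, c, d, h1, h2⟩ := exists_unboundedModel hb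
    refine ⟨B, inferInstance, fun L ⟨e⟩ => mem_K_of_unboundedModel (c := c) (d := d) ?_, h2⟩
    rcases h1 with ⟨g1, g2, g⟩ | ⟨k, g1, g2, g⟩ | ⟨k, g1, g2, g⟩ | ⟨k, k', g1, g2, g⟩
    · exact Or.inl ⟨g1, g2, g.map e.trans⟩
    · exact Or.inr (Or.inl ⟨k, g1, g2, g.map e.trans⟩)
    · exact Or.inr (Or.inr (Or.inl ⟨k, g1, g2, g.map e.trans⟩))
    · exact Or.inr (Or.inr (Or.inr ⟨k, k', g1, g2, g.map e.trans⟩))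

theorem isoInvariant_K : IsoInvariant K.{u} := by
  rintro A B ⟨e⟩ hA
  rcases exists_model_of_mem_K hA with ⟨c, d, h⟩ | ⟨n, t, h1, -, ⟨f⟩⟩
  · refine mem_K_of_unboundedModel (c := c) (d := d) ?_
    rcases h with ⟨g1, g2, g⟩ | ⟨k, g1, g2, g⟩ | ⟨k, g1, g2, g⟩ | ⟨k, k', g1, g2, g⟩
    · exact Or.inl ⟨g1, g2, g.map e.symm.trans⟩
    · exact Or.inr (Or.inl ⟨k, g1, g2, g.map e.symm.trans⟩)
    · exact Or.inr (Or.inr (Or.inl ⟨k, g1, g2, g.map e.symm.trans⟩))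
    · exact Or.inr (Or.inr (Or.inr ⟨k, k', g1, g2, g.map e.symm.trans⟩))
  · exact mem_K_of_word h1 (e.symm.trans f)

theorem countable_sum_lex {X : Type u} {Y : Type v} [Countable X] [Countable Y] :
    Countable (X ⊕ₗ Y) :=
  inferInstanceAs (Countable (X ⊕ Y))

theorem countable_wordOrd (n : ℕ) (t : List (ℕ × ℕ)) : Countable (wordOrd n t) := by
  induction t generalizing n with
  | nil => exact inferInstanceAs (Countable (Fin n))
  | cons q t ih =>
    have := ih q.2
    have : Countable (ℚ ×ₗ Fin q.1) := inferInstanceAs (Countable (ℚ × Fin q.1))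
    have : Countable ((ℚ ×ₗ Fin q.1) ⊕ₗ wordOrd q.2 t) := countable_sum_lex
    exact countable_sum_lex (X := Fin n)

theorem K_subset_countableLO : K.{u} ⊆ CountableLO := by
  intro A hA
  have : Countable ℕᵒᵈ := inferInstanceAs (Countable ℕ)
  rcases exists_model_of_mem_K hA with
    ⟨c, d, ⟨-, -, ⟨e⟩⟩ | ⟨k, -, -, ⟨e⟩⟩ | ⟨k, -, -, ⟨e⟩⟩ | ⟨k, k', -, -, ⟨e⟩⟩⟩ |
      ⟨n, t, -, -, ⟨e⟩⟩
  · have : Countable (ℕ ⊕ₗ ℕᵒᵈ) := countable_sum_lex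
    exact e.injective.countable
  · have : Countable (ℕ ⊕ₗ Fin k) := countable_sum_lex
    exact e.injective.countable
  · have : Countable (Fin k ⊕ₗ ℕᵒᵈ) := countable_sum_lex
    exact e.injective.countable
  · have : Countable (Fin k ⊕ₗ ℤ) := countable_sum_lex
    have : Countable ((Fin k ⊕ₗ ℤ) ⊕ₗ Fin k') := countable_sum_lex
    exact e.injective.countable
  · have := countable_wordOrd n t
    exact e.injective.countable

/-- For `A` in `K` but not in `J`, anything in `J` above `A` would be isomorphic to `A`, and `J` is
closed under isomorphism. -/
theorem not_isUniversal_of_ssubset_K {J C : Set LinOrd.{u}} (hJ : IsoInvariant J) (hJK : J ⊂ K)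
    (hC : K ⊆ C) : ¬ IsUniversal 3 J C := by
  intro h
  obtain ⟨A, hA, hAJ⟩ := exists_of_ssubset hJK
  obtain ⟨B, hB, hAB⟩ := h A (hC hA)
  obtain ⟨e⟩ := nonempty_iso_of_mem_K hA (hJK.1 hB) (leAlpha_three_iff.1 hAB)
  exact hAJ (hJ B A ⟨e.symm⟩ hB)

end Main

end ThreeUniversal

theorem mainTheorem10 :
    ThreeUniversal.IsoInvariant ThreeUniversal.K.{u} ∧
    ThreeUniversal.K.{u} ⊆ ThreeUniversal.CountableLO ∧
    ThreeUniversal.IsUniversal 3 ThreeUniversal.K.{u} ThreeUniversal.LO ∧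
    ThreeUniversal.IsUniversal 3 ThreeUniversal.K.{u} ThreeUniversal.CountableLO ∧
    ∀ J : Set LinOrd.{u}, ThreeUniversal.IsoInvariant J → J ⊂ ThreeUniversal.K →
      ¬ ThreeUniversal.IsUniversal 3 J ThreeUniversal.CountableLO ∧
      ¬ ThreeUniversal.IsUniversal 3 J ThreeUniversal.LO :=
  ⟨ThreeUniversal.isoInvariant_K, ThreeUniversal.K_subset_countableLO,
    ThreeUniversal.isUniversal_three_K _, ThreeUniversal.isUniversal_three_K _,
    fun _ hJ hJK =>
      ⟨ThreeUniversal.not_isUniversal_of_ssubset_K hJ hJK ThreeUniversal.K_subset_countableLO,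
        ThreeUniversal.not_isUniversal_of_ssubset_K hJ hJK (Set.subset_univ _)⟩⟩
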